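/- Let $\Bbbk$ be an algebraically closed field of characteristic zero and let $n\ge 2$. Let $\mathcal E_n=T(V)/(R)$ be the Fomin-Kirillov algebra: $V$ has basis $\{x_{i,j}\mid 1\le i<j\le n\}$, and $R\subset V\otimes V$ is the span of the quadratic relations $$\begin{array}{ll} x_{i,j}^2 & (i<j),\\ x_{i,j}x_{j,k}-x_{j,k}x_{i,k}-x_{i,k}x_{i,j} & (i<j<k),\\ x_{j,k}x_{i,j}-x_{i,k}x_{j,k}-x_{i,j}x_{i,k} & (i<j<k),\\ x_{i,j}x_{k,l}-x_{k,l}x_{i,j} & (\{i,j\}\cap\{k,l\}=\emptyset,\ i<j,\ k<l). \end{array}$$ Let $\mathcal E_n^!=T(V^*)/(R^\perp)$ be its quadratic dual, where $R^\perp\subset V^*\otimes V^*$ is the space of tensors vanishing on $R$; it is graded with all generators in degree one, and $\Bbbk$ is regarded as the trivial $\mathcal E_n^!$-module, on which all generators act by zero. For $A=\mathcal E_n^!$, considered as a left or as a right module over itself, put $$\operatorname{depth} A=\inf\{i\mid \operatorname{Ext}^i_A(\Bbbk,A)\ne 0\}\in\mathbb N\cup\{\infty\},\qquad \operatorname{GKdim}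 A=\limsup_{N\to\infty}\frac{\log\bigl(\sum_{i=0}^N\dim_\Bbbk A_i\bigr)}{\log N}.$$ Then, for every $n\ge 2$, $\operatorname{depth}(\mathcal E_n^!)\le 1$ (on both sides). As a consequence, for every $n\ge 4$, $\operatorname{depth}(\mathcal E_n^!)<\operatorname{GKdim}(\mathcal E_n^!)$ (on both sides). -/

import Mathlib

open scoped TensorProduct ENNReal

universe u

noncomputable section

/-! ### Quadratic algebras and quadratic duals -/

section Quadratic

variable (k : Type u) [Field k] {V : Type u} [AddCommGroup V] [Module k V]

/-- The embedding `V ⊗ V → T(V)`, `v ⊗ w ↦ v * w`, of the degree two part of the tensor algebra. -/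
def tensorToAlgebra : V ⊗[k] V →ₗ[k] TensorAlgebra k V :=
  LinearMap.mul' k (TensorAlgebra k V) ∘ₗ
    TensorProduct.map (TensorAlgebra.ι k) (TensorAlgebra.ι k)

/-- The relation on `T(V)` that sets every element of `R ⊆ V ⊗ V` equal to zero. -/
def quadraticRel (R : Submodule k (V ⊗[k] V)) (a b : TensorAlgebra k V) : Prop :=
  (∃ r ∈ R, a = tensorToAlgebra k r) ∧ b = 0

/-- The quadratic algebra `T(V)/(R)`, where `(R)` is the two-sided ideal generated by
`R ⊆ V ⊗ V`. -/
abbrev QuadraticAlg (R : Submodule k (V ⊗[k] V)) : Type u :=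
  RingQuot (quadraticRel k R)

/-- The space `R^⊥ ⊆ V* ⊗ V*` of all tensors that vanish on `R ⊆ V ⊗ V` under the pairing
`(f ⊗ g)(v ⊗ w) = f v * g w`. -/
def quadraticPerp (R : Submodule k (V ⊗[k] V)) :
    Submodule k (Module.Dual k V ⊗[k] Module.Dual k V) :=
  R.dualAnnihilator.comap (TensorProduct.dualDistrib k V V)

/-- The quadratic dual `T(V*)/(R^⊥)` of `T(V)/(R)`. -/
abbrev QuadraticDual (R : Submodule k (V ⊗[k] V)) : Type u :=
  QuadraticAlg k (quadraticPerp k R)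

/-- The canonical linear map from the space `V` of generators to `T(V)/(R)`. -/
def QuadraticAlg.gen (R : Submodule k (V ⊗[k] V)) : V →ₗ[k] QuadraticAlg k R :=
  (RingQuot.mkAlgHom k (quadraticRel k R)).toLinearMap ∘ₗ TensorAlgebra.ι k

/-- The homogeneous part of degree `i` of `T(V)/(R)`, all generators having degree one: the span
of all products of `i` generators. -/
def QuadraticAlg.piece (R : Submodule k (V ⊗[k] V)) (i : ℕ) : Submodule k (QuadraticAlg k R) :=
  LinearMap.range (QuadraticAlg.gen k R) ^ i

lemma algebraMapInv_tensorToAlgebra (r : V ⊗[k] V) :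
    TensorAlgebra.algebraMapInv (tensorToAlgebra k r) = 0 := by
  induction r using TensorProduct.induction_on with
  | zero => simp
  | tmul v w => simp [tensorToAlgebra, TensorAlgebra.algebraMapInv]
  | add x y hx hy => simp [hx, hy]

/-- The augmentation `T(V)/(R) → k` of the connected graded algebra `T(V)/(R)`: it sends all
generators to zero, and its kernel is the sum of all homogeneous parts of positive degree. -/
def QuadraticAlg.augmentation (R : Submodule k (V ⊗[k] V)) : QuadraticAlg k R →ₐ[k] k :=
  RingQuot.liftAlgHom k ⟨TensorAlgebra.algebraMapInv, by
    rintro _ _ ⟨⟨r, -, rfl⟩, rfl⟩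
    simp [algebraMapInv_tensorToAlgebra]⟩

end Quadratic

/-! ### Gelfand-Kirillov dimension and depth -/

/-- The Gelfand-Kirillov dimension `limsup_{N → ∞} log (∑_{i ≤ N} dim A_i) / log N` of an
algebra `A` with finite-dimensional homogeneous parts `A_i`. -/
def GKdim (k : Type u) [Field k] {A : Type u} [Ring A] [Algebra k A]
    (piece : ℕ → Submodule k A) : EReal :=
  Filter.limsup
    (fun N : ℕ =>
      ((Real.log (∑ i ∈ Finset.range (N + 1), (Module.finrank k (piece i) : ℝ)) /
        Real.log N : ℝ) : EReal))
    Filter.atTop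

/-- The trivial `A`-module `k`, for an augmentation `ε : A → k`: `a` acts as `ε a`. -/
abbrev trivialModule {k A : Type u} [Field k] [Ring A] (ε : A →+* k) : ModuleCat.{u} A :=
  (ModuleCat.restrictScalars ε).obj (ModuleCat.of k k)

/-- The depth `inf {i | Ext^i_A(k, M) ≠ 0}` of a left `A`-module `M`, for an augmented ring
`ε : A → k`; it is `⊤` if all these Ext groups vanish. -/
def moduleDepth {k A : Type u} [Field k] [Ring A] (ε : A →+* k) (M : ModuleCat.{u} A) : ℕ∞ :=
  ⨅ (i : ℕ) (_ : Nontrivial (CategoryTheory.Abelian.Ext.{u} (trivialModule ε) M i)), (i : ℕ∞)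

/-! ### The Fomin-Kirillov algebras and their quadratic duals -/

section FominKirillov

variable (k : Type u) [Field k] (n : ℕ)

/-- The pairs `(i, j)` with `i < j` in an `n`-element ordered set. -/
abbrev IncPair (n : ℕ) : Type := {p : Fin n × Fin n // p.1 < p.2}

/-- The vector space with basis `x_{i,j}`, `i < j`. -/
abbrev FKSpace : Type u := IncPair n → k

variable {n} in
/-- The basis vector `x_{i,j}`, for `i < j`. -/
def fkX (i j : Fin n) (h : i < j) : FKSpace k n := Pi.single ⟨(i, j), h⟩ 1

/-- The defining quadratic relations of the Fomin-Kirillov algebra. -/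
inductive FKRel : FKSpace k n ⊗[k] FKSpace k n → Prop
  | square (i j : Fin n) (hij : i < j) :
      FKRel (fkX k i j hij ⊗ₜ fkX k i j hij)
  | triangle₁ (i j l : Fin n) (hij : i < j) (hjl : j < l) :
      FKRel (fkX k i j hij ⊗ₜ fkX k j l hjl
        - fkX k j l hjl ⊗ₜ fkX k i l (hij.trans hjl)
        - fkX k i l (hij.trans hjl) ⊗ₜ fkX k i j hij)
  | triangle₂ (i j l : Fin n) (hij : i < j) (hjl : j < l) :
      FKRel (fkX k j l hjl ⊗ₜ fkX k i j hij
        - fkX k i l (hij.trans hjl) ⊗ₜ fkX k j l hjl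
        - fkX k i j hij ⊗ₜ fkX k i l (hij.trans hjl))
  | disjoint (i j l m : Fin n) (hij : i < j) (hlm : l < m)
      (h : Disjoint ({i, j} : Set (Fin n)) {l, m}) :
      FKRel (fkX k i j hij ⊗ₜ fkX k l m hlm - fkX k l m hlm ⊗ₜ fkX k i j hij)

/-- The space of quadratic relations of the Fomin-Kirillov algebra. -/
def fkRelations : Submodule k (FKSpace k n ⊗[k] FKSpace k n) :=
  Submodule.span k {r | FKRel k n r}

/-- The Fomin-Kirillov algebra `E_n`. -/
abbrev FominKirillov : Type u := QuadraticAlg k (fkRelations k n)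

/-- The quadratic dual `E_n^!` of the Fomin-Kirillov algebra `E_n`. -/
abbrev FKDual : Type u := QuadraticDual k (fkRelations k n)

/-- The augmentation `E_n^! → k`, which sends all generators to zero. -/
def FKDual.augmentation : FKDual k n →ₐ[k] k :=
  QuadraticAlg.augmentation k (quadraticPerp k (fkRelations k n))

/-- The Gelfand-Kirillov dimension of `E_n^!`. -/
def FKDual.gkdim : EReal :=
  GKdim k (QuadraticAlg.piece k (quadraticPerp k (fkRelations k n)))

/-- The depth of `E_n^!` as a left module over itself. -/
def FKDual.leftDepth : ℕ∞ :=
  moduleDepth (FKDual.augmentation k n).toRingHom (ModuleCat.of (FKDual k n) (FKDual k n))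

/-- The depth of `E_n^!` as a right module over itself, that is, as a left module over the
opposite ring. -/
def FKDual.rightDepth : ℕ∞ :=
  moduleDepth
    ((FKDual.augmentation k n).fromOpposite fun _ _ => Commute.all _ _).toRingHom
    (ModuleCat.of (FKDual k n)ᵐᵒᵖ (FKDual k n))

end FominKirillov

end

/-!
Write `A` for the quadratic dual and `Y i j` for its generators, extended to all pairs of indices
by `Y j i = -Y i j`. The defining relations of `A` then take the uniform shape
`Y i j * Y l m = -(Y l m * Y (s i) (s j))` with `s` the transposition of `l` and `m`
(`IsFKFamily`), and `A` is universal for such families (`isFKFamily_fkGen`, `exists_lift`). The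
relations are stable under reversal of products, so everything below also applies to the opposite
algebra.

The bound on the depth is an instance of Hartshorne's connectedness theorem. The squares
`z i j = Y i j ^ 2` are central, and `Y l m * (z i j - z (s i) (s j)) = 0`. Hence the product `Z`
of all `z i j` with `i ≠ j` kills the ideal `I₂` generated by the differences of the squares. The
ideal `I₂` cuts out the line on which all `z i j` agree, while `I₁ = (Z)` cuts out the union of
the other components, which meets that line only at the origin: every sufficiently long word in
the generators lies in `I₁ + I₂` (`IsFKFamily.exists_word_mem`), because a repeated letter can be
moved next to its first copy. Suppose that `Ext⁰(k, A)` and `Ext¹(k, A)` vanish. Then every linear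
map from `I₁ + I₂` to `A` is multiplication by an element (`extendsByMul_of_word_mem`), and
`I₁ ∩ I₂ = 0`; so there is an `e` with `Z * e = Z` that is annihilated by all differences
(`IsFKFamily.exists_idempotent`). This `e` would have to be the identity on the line and zero on
the other components. The representation `Y i j ↦ (e_i - e_j) * X` over a Clifford algebra sees the
line and forces the constant term of `e` to be `1`; for `n ≥ 3` the representation that
sends one generator to `X` and the others to `0` sees another component and forces it to be `0`
(`IsFKFamily.not_exists_idempotent`). For `n = 2` the algebra is `k[X]` and the claim is direct
(`not_extendsByMul_of_two`).

For `n ≥ 4` the generators of two disjoint pairs act on `k[ℕ × ℕ]` by anticommuting shifts, so the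
part of degree `d` has dimension at least `d + 1`, and the Gelfand-Kirillov dimension exceeds `1`.
-/

noncomputable section

/-! ### Consequences of the vanishing of `Ext⁰` and `Ext¹` -/

section Depth

open CategoryTheory

variable {k B : Type u} [Field k] [Ring B]

theorem subsingleton_ext_of_lt_moduleDepth {ε : B →+* k} {M : ModuleCat.{u} B} {i : ℕ}
    (h : (i : ℕ∞) < moduleDepth ε M) :
    Subsingleton (Abelian.Ext.{u} (trivialModule ε) M i) := by
  by_contra hc
  rw [not_subsingleton_iff_nontrivial] at hc
  exact absurd h (not_lt.mpr (iInf₂_le i hc))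

variable [Algebra k B]

/-- If `Ext⁰(k, M) = 0`, then no nonzero element of `M` is killed by the augmentation ideal: such an
element spans a copy of the trivial module. -/
theorem eq_zero_of_ext_zero (ε : B →ₐ[k] k) (M : ModuleCat.{u} B)
    [Subsingleton (Abelian.Ext.{u} (trivialModule ε.toRingHom) M 0)]
    (x : M) (hx : ∀ b : B, ε b = 0 → b • x = 0) : x = 0 := by
  have hadd (c d : k) :
      algebraMap k B (c + d) • x = algebraMap k B c • x + algebraMap k B d • x := by
    rw [map_add, add_smul]
  have hsmul (b : B) (c : k) :
      algebraMap k B (ε b * c) • x = b • algebraMap k B c • x := by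
    have h := hx (b * algebraMap k B c - algebraMap k B (ε b * c)) (by simp)
    rw [sub_smul, mul_smul, sub_eq_zero] at h
    exact h.symm
  let g : trivialModule ε.toRingHom →ₗ[B] M :=
    { toFun := fun c => algebraMap k B (show k from c) • x
      map_add' := hadd
      map_smul' := hsmul }
  have h0 : ModuleCat.ofHom g = 0 :=
    (Abelian.Ext.homEquiv₀ (X := trivialModule ε.toRingHom) (Y := M)).symm.injective
      (Subsingleton.elim _ _)
  have h1 : g (1 : k) = 0 := by
    have := congrArg (fun f => f.hom (1 : k)) h0
    exact this
  have h2 : g (1 : k) = algebraMap k B 1 • x := rfl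
  rw [h2, map_one, one_smul] at h1
  exact h1

/-- If `π : B → N` is onto and `Ext¹(N, M) = 0`, then every linear map from the kernel of `π` to `M`
extends to `B`, by the long exact sequence of `0 → ker π → B → N → 0`. -/
theorem exists_eq_smul_of_ext_one {N M : ModuleCat.{u} B} (π : B →ₗ[B] N)
    (hπ : Function.Surjective π) [Subsingleton (Abelian.Ext.{u} N M 1)]
    (f : π.ker →ₗ[B] M) : ∃ m : M, ∀ x : π.ker, f x = (x : B) • m := by
  let S : ShortComplex (ModuleCat.{u} B) :=
    ShortComplex.mk (X₁ := ModuleCat.of B π.ker) (X₂ := ModuleCat.of B B) (X₃ := N)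
      (ModuleCat.ofHom π.ker.subtype) (ModuleCat.ofHom π) (by
        ext x
        exact x.2)
  have hS : S.ShortExact :=
    { exact := by
        rw [ShortComplex.moduleCat_exact_iff]
        intro b hb
        exact ⟨⟨b, hb⟩, rfl⟩
      mono_f := (ModuleCat.mono_iff_injective _).2 Subtype.val_injective
      epi_g := (ModuleCat.epi_iff_surjective _).2 hπ }
  obtain ⟨x₂, hx₂⟩ := Abelian.Ext.contravariant_sequence_exact₁ hS M
    (Abelian.Ext.mk₀ (ModuleCat.ofHom f)) (n₁ := 1) rfl
    (Subsingleton.elim (α := Abelian.Ext.{u} N M 1) _ _)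
  obtain ⟨g, rfl⟩ := (Abelian.Ext.mk₀_bijective S.X₂ M).2 x₂
  rw [Abelian.Ext.mk₀_comp_mk₀] at hx₂
  have hg := (Abelian.Ext.mk₀_bijective S.X₁ M).1 hx₂
  refine ⟨g.hom (1 : B), fun x => ?_⟩
  have h1 : f x = g.hom (x : B) := (congrArg (fun q => q.hom x) hg).symm
  have h2 := g.hom.map_smul (x : B) (1 : B)
  rw [h1, ← h2]
  congr 1
  exact (mul_one _).symm

theorem exists_eq_smul_of_subsingleton_ext_one (ε : B →ₐ[k] k) (M : ModuleCat.{u} B)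
    [Subsingleton (Abelian.Ext.{u} (trivialModule ε.toRingHom) M 1)]
    (f : RingHom.ker ε →ₗ[B] M) : ∃ m : M, ∀ x : RingHom.ker ε, f x = (x : B) • m := by
  let π : B →ₗ[B] trivialModule ε.toRingHom :=
    { toFun := fun b => show k from ε b
      map_add' := fun b c => map_add ε b c
      map_smul' := fun b c => map_mul ε b c }
  have hπ (c : k) : ∃ b : B, ε b = c := ⟨algebraMap k B c, ε.commutes c⟩
  exact exists_eq_smul_of_ext_one (N := trivialModule ε.toRingHom) π hπ f

end Depth

/-! ### Extension of linear maps from ideals that contain all long words -/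

section Extension

variable {B : Type*} [Ring B]

/-- Every left linear map from the left ideal `I` to the ring is right multiplication by an element,
that is, extends to the whole ring. -/
def ExtendsByMul (I : Ideal B) : Prop :=
  ∀ f : I →ₗ[B] B, ∃ m : B, ∀ x : I, f x = x * m

theorem extendsByMul_top : ExtendsByMul (⊤ : Ideal B) := fun f =>
  ⟨f ⟨1, trivial⟩, fun x => by
    rw [← smul_eq_mul, ← f.map_smul]
    congr 1
    exact Subtype.ext (mul_one _).symm⟩

variable {P : Ideal B}

/-- The extension property descends along an inclusion `I ≤ J` with `P * J ≤ I`, where `P` is the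
augmentation ideal: for `x ∈ J` a map `f` on `I` yields `b ↦ f (b * x)` on `P`, and the element that
represents this map is the value at `x` of an extension of `f`. -/
theorem ExtendsByMul.of_mul_mem (hP : ∀ b ∈ P, ∀ c, b * c ∈ P)
    (h0 : ∀ x : B, (∀ b ∈ P, b * x = 0) → x = 0) (h1 : ExtendsByMul P)
    {I J : Ideal B} (hIJ : I ≤ J) (hmul : ∀ b ∈ P, ∀ x ∈ J, b * x ∈ I)
    (hJ : ExtendsByMul J) : ExtendsByMul I := by
  intro f
  have key (x : J) : ∃ m : B, ∀ b : P, f ⟨b * x, hmul b b.2 x x.2⟩ = b * m :=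
    h1 { toFun := fun b => f ⟨b * x, hmul b b.2 x x.2⟩
         map_add' := fun b c => by
           rw [← map_add]
           congr 1
           exact Subtype.ext (add_mul _ _ _)
         map_smul' := fun b c => by
           rw [RingHom.id_apply, ← map_smul]
           congr 1
           exact Subtype.ext (mul_assoc _ _ _) }
  choose g hg using key
  have huniq {x y : B} (h : ∀ b ∈ P, b * x = b * y) : x = y :=
    sub_eq_zero.1 (h0 _ fun b hb => by rw [mul_sub, h b hb, sub_self])
  obtain ⟨m, hm⟩ := hJ
    { toFun := g
      map_add' := fun x y => huniq fun b hb => by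
        rw [mul_add, ← hg _ ⟨b, hb⟩, ← hg _ ⟨b, hb⟩, ← hg _ ⟨b, hb⟩, ← map_add]
        congr 1
        exact Subtype.ext (mul_add _ _ _)
      map_smul' := fun c x => huniq fun b hb => by
        rw [RingHom.id_apply, smul_eq_mul, ← mul_assoc, ← hg _ ⟨b, hb⟩,
          ← hg _ ⟨b * c, hP b hb c⟩]
        congr 1
        exact Subtype.ext (mul_assoc _ _ _).symm }
  refine ⟨m, fun x => ?_⟩
  have hx := hm ⟨x, hIJ x.2⟩
  rw [← hx]
  refine huniq fun b hb => ?_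
  change _ = b * g ⟨x, hIJ x.2⟩
  rw [← hg _ ⟨b, hb⟩, ← smul_eq_mul, ← map_smul]
  rfl

variable {ι : Type*} {y : ι → B}

/-- Descent from the whole ring to `I` along the ideals generated by `I` and the words of length
`j`, which shrink to `I` once `j` reaches `r`. -/
theorem extendsByMul_of_word_mem (hy : P = Ideal.span (Set.range y))
    (hP : ∀ b ∈ P, ∀ c, b * c ∈ P)
    (h0 : ∀ x : B, (∀ b ∈ P, b * x = 0) → x = 0) (h1 : ExtendsByMul P)
    {I : Ideal B} {r : ℕ} (hI : ∀ l : List ι, l.length = r → (l.map y).prod ∈ I) :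
    ExtendsByMul I := by
  let W (j : ℕ) : Set B := {w | ∃ l : List ι, l.length = j ∧ w = (l.map y).prod}
  have hmul (j : ℕ) (b) (hb : b ∈ P) (x) (hx : x ∈ I ⊔ Ideal.span (W j)) :
      b * x ∈ I ⊔ Ideal.span (W (j + 1)) := by
    obtain ⟨u, hu, v, hv, rfl⟩ := Submodule.mem_sup.1 hx
    rw [mul_add]
    refine add_mem (Submodule.mem_sup_left (I.mul_mem_left b hu)) (Submodule.mem_sup_right ?_)
    clear hx
    induction hv using Submodule.span_induction generalizing b with
    | mem w hw =>
      obtain ⟨l, hl, rfl⟩ := hw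
      rw [hy] at hb
      induction hb using Submodule.span_induction with
      | mem z hz =>
        obtain ⟨i, rfl⟩ := hz
        exact Ideal.subset_span ⟨i :: l, by simp [hl], by simp⟩
      | zero => simp
      | add p q _ _ hp hq => rw [add_mul]; exact add_mem hp hq
      | smul c p _ hp => rw [smul_eq_mul, mul_assoc]; exact Ideal.mul_mem_left _ _ hp
    | zero => simp
    | add p q _ _ hp hq =>
      rw [mul_add]
      exact add_mem (hp _ hb)
        (hq _ hb)
    | smul c p _ hp =>
      rw [smul_eq_mul, ← mul_assoc]
      exact hp _ (hP b hb c)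
  have hle (j : ℕ) : W (j + 1) ⊆ Ideal.span (W j) := by
    rintro _ ⟨l, hl, rfl⟩
    obtain ⟨i, l, rfl⟩ := List.exists_cons_of_length_eq_add_one hl
    rw [List.map_cons, List.prod_cons]
    exact Ideal.mul_mem_left _ _ (Ideal.subset_span ⟨l, by simpa using hl, rfl⟩)
  have hext (j : ℕ) : ExtendsByMul (I ⊔ Ideal.span (W j)) := by
    induction j with
    | zero =>
      have : I ⊔ Ideal.span (W 0) = ⊤ := by
        rw [Ideal.eq_top_iff_one]
        exact Submodule.mem_sup_right (Ideal.subset_span ⟨[], rfl, by simp⟩)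
      rw [this]
      exact extendsByMul_top
    | succ j ih =>
      exact .of_mul_mem hP h0 h1 (sup_le_sup_left (Ideal.span_le.2 (hle j)) I) (hmul j) ih
  have hr : I ⊔ Ideal.span (W r) = I := by
    rw [sup_eq_left, Ideal.span_le]
    rintro _ ⟨l, hl, rfl⟩
    exact hI l hl
  exact hr ▸ hext r

theorem eq_zero_of_word_mul_eq_zero (hy : P = Ideal.span (Set.range y))
    (h0 : ∀ x : B, (∀ b ∈ P, b * x = 0) → x = 0) {r : ℕ} {x : B}
    (hx : ∀ l : List ι, l.length = r → (l.map y).prod * x = 0) : x = 0 := by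
  induction r with
  | zero => simpa using hx [] rfl
  | succ r ih =>
    refine ih fun l hl => h0 _ fun b hb => ?_
    rw [hy] at hb
    induction hb using Submodule.span_induction with
    | mem z hz =>
      obtain ⟨i, rfl⟩ := hz
      simpa [mul_assoc] using hx (i :: l) (by simp [hl])
    | zero => simp
    | add p q _ _ hp hq => rw [add_mul, hp, hq, add_zero]
    | smul c p _ hp => rw [smul_eq_mul, mul_assoc, hp, mul_zero]

end Extension

section Augmented

variable {k B : Type*} [Field k] [Ring B] [Algebra k B] {ι : Type*} {y : ι → B}

theorem ker_eq_span_range (hgen : Algebra.adjoin k (Set.range y) = ⊤) (ε : B →ₐ[k] k)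
    (hε : ∀ i, ε (y i) = 0) : RingHom.ker ε = Ideal.span (Set.range y) := by
  have key (b : B) : b - algebraMap k B (ε b) ∈ Ideal.span (Set.range y) := by
    have hb : b ∈ Algebra.adjoin k (Set.range y) := hgen ▸ trivial
    induction hb using Algebra.adjoin_induction with
    | mem x hx =>
      have hx' := hx
      obtain ⟨i, rfl⟩ := hx'
      rw [hε, map_zero, sub_zero]
      exact Ideal.subset_span hx
    | algebraMap c => simp
    | add b c _ _ hb hc =>
      rw [map_add, map_add, add_sub_add_comm]
      exact add_mem hb hc
    | mul b c _ _ hb hc =>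
      have : b * c - algebraMap k B (ε (b * c)) =
          b * (c - algebraMap k B (ε c)) +
            algebraMap k B (ε c) * (b - algebraMap k B (ε b)) := by
        rw [map_mul, map_mul, mul_sub, mul_sub, ← Algebra.commutes (ε c) b,
          ← Algebra.commutes (ε c) (algebraMap k B (ε b))]
        abel
      rw [this]
      exact add_mem (Ideal.mul_mem_left _ _ hc) (Ideal.mul_mem_left _ _ hb)
  refine le_antisymm (fun b hb => ?_) (Ideal.span_le.2 ?_)
  · have := key b
    rwa [show ε b = 0 from hb, map_zero, sub_zero] at this
  · rintro _ ⟨i, rfl⟩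
    exact hε i

end Augmented

/-! ### Families that satisfy the relations of the quadratic dual -/

section Family

open Equiv (swap)

/-- Elements `Y i j`, antisymmetric in `i` and `j`, that satisfy the relations of the quadratic dual
of the Fomin-Kirillov algebra. With `s` the transposition of `l` and `m`, the relation `mul_eq` says
that `Y i j` and `Y l m` anticommute if `{i, j}` and `{l, m}` are disjoint, and that `Y i j * Y j m
= Y j m * Y m i` for distinct `i`, `j`, `m`. -/
structure IsFKFamily {n : ℕ} {B : Type*} [Ring B] (Y : Fin n → Fin n → B) : Prop where
  diag (i : Fin n) : Y i i = 0
  neg_swap (i j : Fin n) : Y j i = -Y i j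
  mul_eq (i j l m : Fin n) : Y i j * Y l m = -(Y l m * Y (swap l m i) (swap l m j))

namespace IsFKFamily

variable {n : ℕ} {B : Type*} [Ring B] {Y : Fin n → Fin n → B} (hY : IsFKFamily Y)
include hY

/-- The relation `mul_eq` with the letter `Y l m` moving to the right. -/
theorem mul_eq' (i j l m : Fin n) :
    Y l m * Y i j = -(Y (swap l m i) (swap l m j) * Y l m) := by
  simp [hY.mul_eq (swap l m i) (swap l m j) l m]

theorem op : IsFKFamily fun i j => MulOpposite.op (Y i j) where
  diag i := by simp [hY.diag]
  neg_swap i j := by rw [hY.neg_swap i j, MulOpposite.op_neg]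
  mul_eq i j l m := by
    rw [← MulOpposite.op_mul, ← MulOpposite.op_mul, ← MulOpposite.op_neg, hY.mul_eq']

/-- Moving `Y l m` past `Y i j` twice applies the same transposition twice to `l` and `m`. -/
theorem sq_comm (i j l m : Fin n) : Commute (Y i j ^ 2) (Y l m) := by
  rw [commute_iff_eq, sq, mul_assoc, hY.mul_eq' l m i j, mul_neg, ← mul_assoc, hY.mul_eq' _ _ i j,
    neg_mul, neg_neg, mul_assoc]
  simp

theorem mul_sq_swap (i j l m : Fin n) :
    Y l m * Y i j ^ 2 = Y l m * Y (swap l m i) (swap l m j) ^ 2 := by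
  rw [← (hY.sq_comm i j l m).eq, sq, mul_assoc, hY.mul_eq i j l m, mul_neg, ← mul_assoc,
    hY.mul_eq i j l m, neg_mul, neg_neg, mul_assoc, sq]

theorem sq_swap (i j : Fin n) : Y j i ^ 2 = Y i j ^ 2 := by
  rw [hY.neg_swap, neg_sq]

theorem mul_word (i j : Fin n) (l : List (Fin n × Fin n)) :
    Y i j * (l.map fun p => Y p.1 p.2).prod =
      (-1) ^ l.length *
        (((l.map fun p => (swap i j p.1, swap i j p.2)).map fun p => Y p.1 p.2).prod * Y i j) := by
  induction l with
  | nil => simp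
  | cons p l ih =>
    rw [List.map_cons, List.prod_cons, ← mul_assoc, hY.mul_eq', neg_mul, mul_assoc, ih,
      List.map_cons, List.map_cons, List.prod_cons, List.length_cons, pow_succ']
    simp only [← mul_assoc]
    rw [((Commute.neg_one_right _).pow_right l.length).eq (a := Y _ _)]
    simp [mul_assoc]

theorem commute_sq {k : Type*} [CommRing k] [Algebra k B]
    (hgen : Algebra.adjoin k (Set.range fun p : Fin n × Fin n => Y p.1 p.2) = ⊤)
    (i j : Fin n) (b : B) : Commute (Y i j ^ 2) b := by
  have hb : b ∈ Algebra.adjoin k (Set.range fun p : Fin n × Fin n => Y p.1 p.2) :=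
    hgen ▸ trivial
  induction hb using Algebra.adjoin_induction with
  | mem x hx => obtain ⟨p, rfl⟩ := hx; exact hY.sq_comm _ _ _ _
  | algebraMap c => exact (Algebra.commutes c _).symm
  | add b c _ _ hb hc => exact hb.add_right hc
  | mul b c _ _ hb hc => exact hb.mul_right hc

variable (hc : ∀ i j b, Commute (Y i j ^ 2) b)
include hc

/-- A word with a repeated letter is, up to sign, a central square times a word that is shorter by
two letters: move the first copy of the letter to the right until it meets the second one. -/
theorem exists_word_eq_sq_mul {l : List (Fin n × Fin n)} (hl : ¬ l.Nodup) :
    ∃ (i j : Fin n) (l' : List (Fin n × Fin n)) (e : ℕ), l'.length + 2 = l.length ∧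
      (l.map fun p => Y p.1 p.2).prod =
        (-1) ^ e * (Y i j ^ 2 * (l'.map fun p => Y p.1 p.2).prod) := by
  induction l with
  | nil => simp at hl
  | cons p l ih =>
    by_cases hp : p ∈ l
    · obtain ⟨s, t, rfl⟩ := List.append_of_mem hp
      refine ⟨p.1, p.2, s.map (fun q => (swap p.1 p.2 q.1, swap p.1 p.2 q.2)) ++ t,
        s.length, by simp; omega, ?_⟩
      rw [List.map_cons, List.map_append, List.map_cons, List.prod_cons, List.prod_append,
        List.prod_cons, ← mul_assoc, hY.mul_word, List.map_append, List.prod_append,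
        ← mul_assoc (Y p.1 p.2 ^ 2), (hc p.1 p.2 _).eq, sq]
      simp only [mul_assoc]
    · obtain ⟨i, j, l', e, hl', h⟩ := ih (by simpa [hp] using hl)
      refine ⟨i, j, p :: l', e, by simp [← hl'], ?_⟩
      rw [List.map_cons, List.map_cons, List.prod_cons, List.prod_cons, h, ← mul_assoc,
        ((Commute.neg_one_right (Y p.1 p.2)).pow_right e).eq, mul_assoc,
        ← mul_assoc (Y p.1 p.2), ← (hc i j (Y p.1 p.2)).eq, mul_assoc]

end IsFKFamily

/-- The ideal generated by all differences of the squares `Y i j ^ 2` with `i ≠ j`. It is introduced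
as a left ideal; it is two-sided when the squares are central. -/
def sqDiffIdeal {n : ℕ} {B : Type*} [Ring B] (Y : Fin n → Fin n → B) : Ideal B :=
  Ideal.span {x | ∃ i j l m, i ≠ j ∧ l ≠ m ∧ x = Y i j ^ 2 - Y l m ^ 2}

/-- The product of the squares `Y i j ^ 2` over all ordered pairs with `i ≠ j`. Every square occurs
twice, since `Y j i ^ 2 = Y i j ^ 2`. -/
def sqProd {n : ℕ} {B : Type*} [Ring B] (Y : Fin n → Fin n → B) : B :=
  (((Finset.univ : Finset (Fin n)).offDiag.toList).map fun p => Y p.1 p.2 ^ 2).prod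

namespace IsFKFamily

variable {n : ℕ} {B : Type*} [Ring B] {Y : Fin n → Fin n → B}

theorem sq_sub_sq_mem {i j l m : Fin n} (h : i ≠ j) (h' : l ≠ m) :
    Y i j ^ 2 - Y l m ^ 2 ∈ sqDiffIdeal Y :=
  Ideal.subset_span ⟨i, j, l, m, h, h', rfl⟩

/-! ### The central squares and the two ideals -/

section Central

variable (hc : ∀ i j b, Commute (Y i j ^ 2) b)
include hc

theorem commute_sqProd (b : B) : Commute (sqProd Y) b := by
  refine Commute.list_prod_left _ _ fun x hx => ?_
  obtain ⟨p, -, rfl⟩ := List.mem_map.1 hx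
  exact hc _ _ _

theorem mul_mem_sqDiffIdeal {x : B} (hx : x ∈ sqDiffIdeal Y) (b : B) :
    x * b ∈ sqDiffIdeal Y := by
  induction hx using Submodule.span_induction with
  | mem x hx =>
    obtain ⟨i, j, l, m, h, h', rfl⟩ := hx
    rw [((hc i j b).sub_left (hc l m b)).eq]
    exact Ideal.mul_mem_left _ _ (sq_sub_sq_mem h h')
  | zero => simp
  | add p q _ _ hp hq => rw [add_mul]; exact add_mem hp hq
  | smul c p _ hp => rw [smul_eq_mul, mul_assoc]; exact Ideal.mul_mem_left _ _ hp

theorem sqProd_sub_pow_mem {i₀ j₀ : Fin n} (h₀ : i₀ ≠ j₀) :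
    sqProd Y - (Y i₀ j₀ ^ 2) ^ (Finset.univ : Finset (Fin n)).offDiag.card ∈
      sqDiffIdeal Y := by
  rw [sqProd, ← Finset.length_toList]
  have hL : ∀ p ∈ (Finset.univ : Finset (Fin n)).offDiag.toList, p.1 ≠ p.2 := by simp
  generalize (Finset.univ : Finset (Fin n)).offDiag.toList = L at hL
  induction L with
  | nil => simp
  | cons p L ih =>
    rw [List.map_cons, List.prod_cons, List.length_cons, pow_succ (Y i₀ j₀ ^ 2)]
    have : Y p.1 p.2 ^ 2 * (L.map fun p => Y p.1 p.2 ^ 2).prod -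
        (Y i₀ j₀ ^ 2) ^ L.length * Y i₀ j₀ ^ 2 =
        Y p.1 p.2 ^ 2 * ((L.map fun p => Y p.1 p.2 ^ 2).prod - (Y i₀ j₀ ^ 2) ^ L.length) +
          (Y i₀ j₀ ^ 2) ^ L.length * (Y p.1 p.2 ^ 2 - Y i₀ j₀ ^ 2) := by
      rw [mul_sub, mul_sub, (hc p.1 p.2 ((Y i₀ j₀ ^ 2) ^ L.length)).eq]
      abel
    rw [this]
    exact add_mem (Ideal.mul_mem_left _ _ (ih fun q hq => hL q (List.mem_cons_of_mem _ hq)))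
      (Ideal.mul_mem_left _ _ (sq_sub_sq_mem (hL p List.mem_cons_self) h₀))

variable (hY : IsFKFamily Y)
include hY

theorem sqProd_mul_sq_swap (i j : Fin n) {l m : Fin n} (h : l ≠ m) :
    sqProd Y * Y i j ^ 2 = sqProd Y * Y (swap l m i) (swap l m j) ^ 2 := by
  have hmem : (l, m) ∈ (Finset.univ : Finset (Fin n)).offDiag.toList := by simpa using h
  obtain ⟨s, t, hst⟩ := List.append_of_mem hmem
  have hZ : sqProd Y = (s.map fun p => Y p.1 p.2 ^ 2).prod *
      (t.map fun p => Y p.1 p.2 ^ 2).prod * Y l m * Y l m := by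
    rw [sqProd, hst, List.map_append, List.map_cons, List.prod_append, List.prod_cons,
      (hc l m _).eq, sq]
    simp only [mul_assoc]
  rw [hZ, mul_assoc, mul_assoc _ _ (Y (swap l m i) _ ^ 2), hY.mul_sq_swap]

/-- On multiples of `sqProd Y` all squares agree, since transpositions connect all pairs. -/
theorem sqProd_mul_sq {i j l m : Fin n} (h : i ≠ j) (h' : l ≠ m) :
    sqProd Y * Y i j ^ 2 = sqProd Y * Y l m ^ 2 := by
  -- moving one endpoint of an edge
  have step {i j l : Fin n} (hj : i ≠ j) (hl : i ≠ l) :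
      sqProd Y * Y i j ^ 2 = sqProd Y * Y i l ^ 2 := by
    rcases eq_or_ne j l with rfl | hjl
    · rfl
    · rw [sqProd_mul_sq_swap hc hY i j hjl, Equiv.swap_apply_of_ne_of_ne hj hl,
        Equiv.swap_apply_left]
  by_cases hil : i = l
  · subst hil
    exact step h h'
  · rw [step h hil, ← hY.sq_swap i l, step (Ne.symm hil) h']

theorem sqProd_mul_eq_zero {x : B} (hx : x ∈ sqDiffIdeal Y) : sqProd Y * x = 0 := by
  rw [(commute_sqProd hc x).eq]
  induction hx using Submodule.span_induction with
  | mem x hx =>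
    obtain ⟨i, j, l, m, h, h', rfl⟩ := hx
    rw [← (commute_sqProd hc _).eq, mul_sub, sqProd_mul_sq hc hY h h', sub_self]
  | zero => simp
  | add p q _ _ hp hq => rw [add_mul, hp, hq, add_zero]
  | smul c p _ hp => rw [smul_eq_mul, mul_assoc, hp, mul_zero]

/-- There are `n * n` letters, so that a word longer than `n * n` repeats a letter and splits off a
square, which may be replaced by `Y i₀ j₀ ^ 2` modulo the differences. -/
theorem exists_word_sub_pow_mul_mem {i₀ j₀ : Fin n} (h₀ : i₀ ≠ j₀) (r : ℕ)
    {l : List (Fin n × Fin n)} (hl : n * n + 2 * r ≤ l.length) :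
    ∃ b : B, (l.map fun p => Y p.1 p.2).prod - (Y i₀ j₀ ^ 2) ^ r * b ∈ sqDiffIdeal Y := by
  induction r generalizing l with
  | zero => exact ⟨_, by rw [pow_zero, one_mul, sub_self]; exact zero_mem _⟩
  | succ r ih =>
    have hdup : ¬ l.Nodup := fun hn => by
      have := hn.length_le_card
      simp at this
      omega
    obtain ⟨i, j, l', e, hl', h⟩ := hY.exists_word_eq_sq_mul hc hdup
    rcases eq_or_ne i j with rfl | hij
    · exact ⟨0, by simp [h, hY.diag]⟩
    · obtain ⟨b, hb⟩ := ih (l := l') (by omega)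
      refine ⟨(-1) ^ e * b, ?_⟩
      set w := (l'.map fun p => Y p.1 p.2).prod
      have hcr := (hc i₀ j₀ ((-1) ^ e)).pow_left (r + 1)
      have : (-1) ^ e * (Y i j ^ 2 * w) - (Y i₀ j₀ ^ 2) ^ (r + 1) * ((-1) ^ e * b) =
          (-1) ^ e * (Y i j ^ 2 * (w - (Y i₀ j₀ ^ 2) ^ r * b) +
            (Y i j ^ 2 - Y i₀ j₀ ^ 2) * ((Y i₀ j₀ ^ 2) ^ r * b)) := by
        rw [← mul_assoc _ _ b, hcr.eq, mul_assoc, pow_succ' (Y i₀ j₀ ^ 2), ← mul_sub]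
        congr 1
        rw [mul_sub, sub_mul, mul_assoc (Y i₀ j₀ ^ 2)]
        abel
      rw [h, this]
      exact Ideal.mul_mem_left _ _ (add_mem (Ideal.mul_mem_left _ _ hb)
        (mul_mem_sqDiffIdeal hc (sq_sub_sq_mem hij h₀) _))

theorem exists_word_mem (h2 : 2 ≤ n) : ∃ r : ℕ, ∀ l : List (Fin n × Fin n), l.length = r →
    (l.map fun p => Y p.1 p.2).prod ∈ Ideal.span {sqProd Y} ⊔ sqDiffIdeal Y := by
  have h₀ : (⟨0, by omega⟩ : Fin n) ≠ ⟨1, by omega⟩ := by simp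
  refine ⟨n * n + 2 * (Finset.univ : Finset (Fin n)).offDiag.card, fun l hl => ?_⟩
  obtain ⟨b, hb⟩ := exists_word_sub_pow_mul_mem hc hY h₀
    (Finset.univ : Finset (Fin n)).offDiag.card hl.ge
  have hZ := mul_mem_sqDiffIdeal hc (sqProd_sub_pow_mem hc h₀) b
  have hZb : sqProd Y * b ∈ Ideal.span {sqProd Y} := by
    rw [(commute_sqProd hc b).eq]
    exact Ideal.mul_mem_left _ _ (Ideal.subset_span rfl)
  have := add_mem (Submodule.mem_sup_left hZb)
    (Submodule.mem_sup_right (sub_mem hb hZ))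
  rw [sub_mul] at this
  convert this using 1
  abel

end Central

/-! ### The separating element -/

section Hartshorne

variable {k : Type*} [Field k] [Algebra k B]

/-- If `Ext⁰(k, B) = Ext¹(k, B) = 0`, in the form of `h0` and `h1`, then the map that is the
identity on `(sqProd Y)` and zero on the differences of the squares is multiplication by some `e`.
-/
theorem exists_idempotent (h2 : 2 ≤ n) (hY : IsFKFamily Y)
    (hgen : Algebra.adjoin k (Set.range fun p : Fin n × Fin n => Y p.1 p.2) = ⊤)
    (ε : B →ₐ[k] k) (hε : ∀ i j, ε (Y i j) = 0)
    (h0 : ∀ x : B, (∀ b ∈ RingHom.ker ε, b * x = 0) → x = 0)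
    (h1 : ExtendsByMul (RingHom.ker ε)) :
    ∃ e : B, sqProd Y * e = sqProd Y ∧
      ∀ i j l m, i ≠ j → l ≠ m → (Y i j ^ 2 - Y l m ^ 2) * e = 0 := by
  have hc := hY.commute_sq hgen
  have hker := ker_eq_span_range hgen ε fun p => hε p.1 p.2
  obtain ⟨r, hr⟩ := exists_word_mem hc hY h2
  have hext : ExtendsByMul (Ideal.span {sqProd Y} ⊔ sqDiffIdeal Y) :=
    extendsByMul_of_word_mem hker
      (fun b hb c => by
        rw [RingHom.mem_ker] at hb ⊢
        rw [map_mul, hb, zero_mul]) h0 h1 hr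
  have hdisj : Disjoint (Ideal.span {sqProd Y}) (sqDiffIdeal Y) := by
    rw [Submodule.disjoint_def]
    intro x hx hx'
    refine eq_zero_of_word_mul_eq_zero hker h0 (r := r) fun l hl => ?_
    -- an element of the intersection is killed by both ideals, hence by all long words
    obtain ⟨u, hu, v, hv, huv⟩ := Submodule.mem_sup.1 (hr l hl)
    rw [← huv, add_mul]
    obtain ⟨a, rfl⟩ := Ideal.mem_span_singleton'.1 hu
    obtain ⟨c, rfl⟩ := Ideal.mem_span_singleton'.1 hx
    rw [mul_assoc, sqProd_mul_eq_zero hc hY hx', mul_zero, zero_add, ← mul_assoc,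
      ← (commute_sqProd hc _).eq, sqProd_mul_eq_zero hc hY (mul_mem_sqDiffIdeal hc hv c)]
  let f₁ : B →ₗ.[B] B := ⟨Ideal.span {sqProd Y}, Submodule.subtype _⟩
  let f₂ : B →ₗ.[B] B := ⟨sqDiffIdeal Y, 0⟩
  have hag : ∀ (x : f₁.domain) (y : f₂.domain), (x : B) = y → f₁ x = f₂ y :=
    LinearPMap.sup_h_of_disjoint f₁ f₂ hdisj
  obtain ⟨e, he⟩ := hext (f₁.sup f₂ hag).toFun
  refine ⟨e, ?_, fun i j l m h h' => ?_⟩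
  · have hm : sqProd Y ∈ f₁.domain := Ideal.subset_span rfl
    rw [← he ⟨sqProd Y, Submodule.mem_sup_left hm⟩]
    exact ((f₁.left_le_sup f₂ hag).2 (x := ⟨_, hm⟩) rfl).symm
  · have hm : Y i j ^ 2 - Y l m ^ 2 ∈ f₂.domain := sq_sub_sq_mem h h'
    rw [← he ⟨_, Submodule.mem_sup_right hm⟩]
    exact ((f₁.right_le_sup f₂ hag).2 (x := ⟨_, hm⟩) rfl).symm

open Polynomial

theorem constantCoeff_algHom {R : Type*} [Ring R] [Algebra k R]
    (hgen : Algebra.adjoin k (Set.range fun p : Fin n × Fin n => Y p.1 p.2) = ⊤)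
    (ε : B →ₐ[k] k) (hε : ∀ i j, ε (Y i j) = 0)
    (φ : B →ₐ[k] R[X]) {v : Fin n → Fin n → R} (hφ : ∀ i j, φ (Y i j) = C (v i j) * X)
    (b : B) : (φ b).coeff 0 = algebraMap k R (ε b) := by
  have hb : b ∈ Algebra.adjoin k (Set.range fun p : Fin n × Fin n => Y p.1 p.2) :=
    hgen ▸ trivial
  induction hb using Algebra.adjoin_induction with
  | mem x hx => obtain ⟨p, rfl⟩ := hx; simp [hφ, hε]
  | algebraMap c => simp [Polynomial.algebraMap_apply]
  | add b c _ _ hb hc => simp [hb, hc]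
  | mul b c _ _ hb hc => simp [mul_coeff_zero, hb, hc]

theorem eq_zero_of_algHom_sqProd_mul {R : Type*} [Ring R] [Algebra k R] [CharZero k]
    (φ : B →ₐ[k] R[X]) {v : Fin n → Fin n → R} (hφ : ∀ i j, φ (Y i j) = C (v i j) * X)
    (hv : ∀ i j, i ≠ j → v i j * v i j = 2) {q : R[X]} (hq : φ (sqProd Y) * q = 0) :
    q = 0 := by
  rw [sqProd, map_list_prod, List.map_map] at hq
  have hL : ∀ p ∈ (Finset.univ : Finset (Fin n)).offDiag.toList, p.1 ≠ p.2 := by simp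
  generalize (Finset.univ : Finset (Fin n)).offDiag.toList = L at hL hq
  induction L with
  | nil => simpa using hq
  | cons p L ih =>
    refine ih (fun q hq => hL q (List.mem_cons_of_mem _ hq)) ?_
    rw [List.map_cons, List.prod_cons, mul_assoc] at hq
    generalize (List.map _ L).prod * q = q' at hq
    have h2 : φ (Y p.1 p.2 ^ 2) = algebraMap k R[X] 2 * X ^ 2 := by
      rw [map_pow, hφ, sq, sq, mul_assoc, ← mul_assoc X, X_mul_C, mul_assoc, ← mul_assoc,
        ← C_mul, hv _ _ (hL p List.mem_cons_self), Polynomial.algebraMap_apply,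
        map_ofNat (algebraMap k R)]
    rw [Function.comp_apply, h2, mul_assoc, ← Algebra.smul_def, smul_eq_zero_iff_right two_ne_zero]
      at hq
    ext d
    have := congrArg (fun q => coeff q (d + 2)) hq
    simpa using this

/-- The element `e` cannot exist: `φ (sqProd Y)` is no zero divisor, so `φ e = 1`, and `ψ` does not
kill `Y a b ^ 2 - Y c d ^ 2`, so `ψ e = 0`; but both have the augmentation of `e` as constant term.
-/
theorem not_exists_idempotent {R : Type*} [Ring R] [Nontrivial R] [Algebra k R] [CharZero k]
    (hgen : Algebra.adjoin k (Set.range fun p : Fin n × Fin n => Y p.1 p.2) = ⊤)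
    (ε : B →ₐ[k] k) (hε : ∀ i j, ε (Y i j) = 0)
    (φ : B →ₐ[k] R[X]) {v : Fin n → Fin n → R} (hφ : ∀ i j, φ (Y i j) = C (v i j) * X)
    (hv : ∀ i j, i ≠ j → v i j * v i j = 2)
    (ψ : B →ₐ[k] k[X]) {w : Fin n → Fin n → k} (hψ : ∀ i j, ψ (Y i j) = C (w i j) * X)
    {a b c d : Fin n} (hab : a ≠ b) (hcd : c ≠ d) (hwab : w a b ≠ 0) (hwcd : w c d = 0) {e : B}
    (he : sqProd Y * e = sqProd Y)
    (he' : ∀ i j l m, i ≠ j → l ≠ m → (Y i j ^ 2 - Y l m ^ 2) * e = 0) : False := by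
  have h1 : φ e = 1 := by
    rw [← sub_eq_zero]
    refine eq_zero_of_algHom_sqProd_mul φ hφ hv ?_
    rw [mul_sub, mul_one, ← map_mul, he, sub_self]
  have h2 : ψ e = 0 := by
    have := congrArg ψ (he' a b c d hab hcd)
    rw [map_mul, map_sub, map_pow, map_pow, hψ, hψ, hwcd, C_0, zero_mul, zero_pow two_ne_zero,
      sub_zero, map_zero] at this
    exact (mul_eq_zero.1 this).resolve_left
      (pow_ne_zero _ (mul_ne_zero (C_ne_zero.2 hwab) X_ne_zero))
  have h3 := constantCoeff_algHom hgen ε hε φ hφ e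
  have h4 := constantCoeff_algHom hgen ε hε ψ hψ e
  rw [h2, coeff_zero, Algebra.algebraMap_self_apply] at h4
  rw [h1, ← h4, map_zero, coeff_one_zero] at h3
  exact one_ne_zero h3

end Hartshorne

end IsFKFamily

end Family

/-! ### Oriented generators and the relations -/

section Presentation

open Equiv (swap)

variable (k : Type u) [Field k] {n : ℕ}

/-- The generator `x_{i,j}` for arbitrary `i` and `j`, with `x_{j,i} = -x_{i,j}` and `x_{i,i} = 0`.
-/
def fkOriented (i j : Fin n) : FKSpace k n := fun p =>
  (if p.1 = (i, j) then 1 else 0) - (if p.1 = (j, i) then 1 else 0)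

/-- The coordinate function dual to `x_{i,j}`, for arbitrary `i` and `j` and antisymmetric in them.
-/
def fkCoord (i j : Fin n) : Module.Dual k (FKSpace k n) :=
  ∑ p : IncPair n, fkOriented k i j p • LinearMap.proj p

theorem fkOriented_swap (i j : Fin n) : fkOriented k j i = -fkOriented k i j := by
  ext p; simp [fkOriented]

theorem fkOriented_self (i : Fin n) : fkOriented k i i = 0 := by
  ext p; simp [fkOriented]

theorem fkCoord_self (i : Fin n) : fkCoord k i i = 0 :=
  LinearMap.ext fun v => by simp [fkCoord, fkOriented]

theorem fkCoord_swap (i j : Fin n) : fkCoord k j i = -fkCoord k i j := by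
  refine LinearMap.ext fun v => ?_
  simp [fkCoord, fkOriented_swap k i j]

theorem fkX_eq_fkOriented (i j : Fin n) (h : i < j) : fkX k i j h = fkOriented k i j := by
  ext ⟨⟨a, b⟩, hp⟩
  have : ¬ (a = j ∧ b = i) := by rintro ⟨rfl, rfl⟩; exact absurd h (not_lt.2 hp.le)
  simp [fkX, fkOriented, Pi.single_apply, this]

theorem fkCoord_apply (i j a b : Fin n) : fkCoord k i j (fkOriented k a b) =
    (if i = a ∧ j = b then 1 else 0) - (if i = b ∧ j = a then 1 else 0) := by
  have key {i j a b : Fin n} (h : a < b) : fkCoord k i j (fkOriented k a b) =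
      (if i = a ∧ j = b then 1 else 0) - (if i = b ∧ j = a then 1 else 0) := by
    rw [← fkX_eq_fkOriented k a b h, fkX]
    simp [fkCoord, Pi.single_apply, fkOriented, eq_comm, and_comm]
  rcases lt_trichotomy a b with h | rfl | h
  · exact key h
  · simp [fkOriented_self]
  · rw [fkOriented_swap k b a, map_neg, key h, neg_sub]

/-- If the first factor is nonzero, then `{l, m} = {a, b}`, so that the two transpositions agree; it
remains to use that the pairing is invariant under permutations. -/
theorem fkCoord_mul_fkCoord_swap (i j l m a b c d : Fin n) :
    fkCoord k l m (fkOriented k a b) *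
      fkCoord k (swap l m i) (swap l m j) (fkOriented k c d) =
    fkCoord k l m (fkOriented k a b) *
      fkCoord k i j (fkOriented k (swap a b c) (swap a b d)) := by
  rw [fkCoord_apply k l m]
  have hs {s : Equiv.Perm (Fin n)} (hs : ∀ x, s (s x) = x) (x y : Fin n) : s x = y ↔ x = s y :=
    ⟨fun h => by rw [← h, hs], fun h => by rw [h, hs]⟩
  by_cases h₁ : l = a ∧ m = b
  · obtain ⟨rfl, rfl⟩ := h₁
    simp only [fkCoord_apply, hs (Equiv.swap_apply_self l m)]
  · by_cases h₂ : l = b ∧ m = a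
    · obtain ⟨rfl, rfl⟩ := h₂
      rw [Equiv.swap_comm m l]
      simp only [fkCoord_apply, hs (Equiv.swap_apply_self l m)]
    · simp [h₁, h₂]

/-- The relations of the Fomin-Kirillov algebra in terms of the oriented generators; the two kinds
of triangle relations become the two cyclic orientations of one relation. -/
inductive OrientedRel : FKSpace k n ⊗[k] FKSpace k n → Prop
  | square (i j : Fin n) : OrientedRel (fkOriented k i j ⊗ₜ fkOriented k i j)
  | triangle (a b c : Fin n) (hab : a ≠ b) (hbc : b ≠ c) (hca : c ≠ a) :
      OrientedRel (fkOriented k a b ⊗ₜ fkOriented k b c + fkOriented k b c ⊗ₜ fkOriented k c a +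
        fkOriented k c a ⊗ₜ fkOriented k a b)
  | disjoint (a b c d : Fin n) (hac : a ≠ c) (had : a ≠ d) (hbc : b ≠ c) (hbd : b ≠ d) :
      OrientedRel (fkOriented k a b ⊗ₜ fkOriented k c d - fkOriented k c d ⊗ₜ fkOriented k a b)

theorem FKRel.oriented {r : FKSpace k n ⊗[k] FKSpace k n} (h : FKRel k n r) :
    OrientedRel k r := by
  cases h with
  | square i j hij => rw [fkX_eq_fkOriented]; exact .square i j
  | triangle₁ i j l hij hjl =>
    have := OrientedRel.triangle (k := k) i j l hij.ne hjl.ne (hij.trans hjl).ne'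
    simp only [fkX_eq_fkOriented]
    convert this using 1
    rw [fkOriented_swap k i l, TensorProduct.tmul_neg, TensorProduct.neg_tmul]
    abel
  | triangle₂ i j l hij hjl =>
    have := OrientedRel.triangle (k := k) l j i hjl.ne' hij.ne' (hij.trans hjl).ne
    simp only [fkX_eq_fkOriented]
    convert this using 1
    rw [fkOriented_swap k i j, fkOriented_swap k j l]
    simp only [TensorProduct.tmul_neg, TensorProduct.neg_tmul]
    abel
  | disjoint i j l m hij hlm h =>
    simp only [fkX_eq_fkOriented]
    simp only [Set.disjoint_insert_left, Set.disjoint_singleton_left, Set.mem_insert_iff,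
      Set.mem_singleton_iff, not_or] at h
    obtain ⟨⟨h1, h2⟩, h3, h4⟩ := h
    exact .disjoint _ _ _ _ h1 h2 h3 h4

theorem OrientedRel.mem {r : FKSpace k n ⊗[k] FKSpace k n} (h : OrientedRel k r) :
    r ∈ fkRelations k n := by
  have hrel {s : FKSpace k n ⊗[k] FKSpace k n} (hs : FKRel k n s) : s ∈ fkRelations k n :=
    Submodule.subset_span hs
  cases h with
  | square a b =>
    have key {a b : Fin n} (h : a < b) :
        fkOriented k a b ⊗ₜ fkOriented k a b ∈ fkRelations k n := by
      simp only [← fkX_eq_fkOriented k a b h]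
      exact hrel (.square a b h)
    rcases lt_trichotomy a b with h | rfl | h
    · exact key h
    · simp [fkOriented_self]
    · simpa [fkOriented_swap k b a, TensorProduct.tmul_neg, TensorProduct.neg_tmul] using key h
  | triangle a b c hab hbc hca =>
    let T (a b c : Fin n) : FKSpace k n ⊗[k] FKSpace k n :=
      fkOriented k a b ⊗ₜ fkOriented k b c + fkOriented k b c ⊗ₜ fkOriented k c a +
        fkOriented k c a ⊗ₜ fkOriented k a b
    have rot (a b c : Fin n) (h : T a b c ∈ fkRelations k n) : T b c a ∈ fkRelations k n := by
      convert h using 1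
      simp only [T]
      abel
    have up {a b c : Fin n} (hab : a < b) (hbc : b < c) : T a b c ∈ fkRelations k n := by
      have := hrel (FKRel.triangle₁ (k := k) a b c hab hbc)
      simp only [fkX_eq_fkOriented] at this
      convert this using 1
      simp only [T, fkOriented_swap k a c, TensorProduct.tmul_neg, TensorProduct.neg_tmul]
      abel
    have down {a b c : Fin n} (hab : a < b) (hbc : b < c) : T c b a ∈ fkRelations k n := by
      have := hrel (FKRel.triangle₂ (k := k) a b c hab hbc)
      simp only [fkX_eq_fkOriented] at this
      convert this using 1
      simp only [T, fkOriented_swap k a b, fkOriented_swap k b c, TensorProduct.tmul_neg,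
        TensorProduct.neg_tmul]
      abel
    change T a b c ∈ fkRelations k n
    rcases hab.lt_or_gt with h1 | h1 <;> rcases hbc.lt_or_gt with h2 | h2 <;>
      rcases hca.lt_or_gt with h3 | h3
    · exact absurd (h1.trans h2) h3.asymm
    · exact up h1 h2
    · exact rot _ _ _ (up h3 h1)
    · exact rot _ _ _ (rot _ _ _ (down h3 h2))
    · exact rot _ _ _ (rot _ _ _ (up h2 h3))
    · exact rot _ _ _ (down h1 h3)
    · exact down h2 h1
    · exact absurd (h2.trans h1) h3.asymm
  | disjoint a b c d hac had hbc hbd =>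
    let D (a b c d : Fin n) : FKSpace k n ⊗[k] FKSpace k n :=
      fkOriented k a b ⊗ₜ fkOriented k c d - fkOriented k c d ⊗ₜ fkOriented k a b
    have flip (a b c d : Fin n) (h : D a b c d ∈ fkRelations k n) :
        D b a c d ∈ fkRelations k n := by
      rw [← neg_mem_iff]
      convert h using 1
      simp only [D, fkOriented_swap k a b, TensorProduct.tmul_neg, TensorProduct.neg_tmul]
      abel
    have exch (a b c d : Fin n) (h : D a b c d ∈ fkRelations k n) :
        D c d a b ∈ fkRelations k n := by
      rw [← neg_mem_iff]
      convert h using 1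
      simp only [D]
      abel
    have key {a b c d : Fin n} (hac : a ≠ c) (had : a ≠ d) (hbc : b ≠ c) (hbd : b ≠ d)
        (hab : a < b) (hcd : c < d) : D a b c d ∈ fkRelations k n := by
      have := hrel (FKRel.disjoint (k := k) a b c d hab hcd
        (by simp [*, Ne.symm]))
      simp only [fkX_eq_fkOriented] at this
      exact this
    have key' {a b c d : Fin n} (hac : a ≠ c) (had : a ≠ d) (hbc : b ≠ c) (hbd : b ≠ d)
        (hcd : c < d) : D a b c d ∈ fkRelations k n := by
      rcases lt_trichotomy a b with h | rfl | h
      · exact key hac had hbc hbd h hcd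
      · simp [D, fkOriented_self]
      · exact flip _ _ _ _ (key hbc hbd hac had h hcd)
    change D a b c d ∈ fkRelations k n
    rcases lt_trichotomy c d with h | rfl | h
    · exact key' hac had hbc hbd h
    · simp [D, fkOriented_self]
    · exact exch _ _ _ _ (flip _ _ _ _ (exch _ _ _ _ (key' had hac hbd hbc h)))

theorem fkCoord_rel_mem_perp (i j l m : Fin n) :
    fkCoord k i j ⊗ₜ fkCoord k l m + fkCoord k l m ⊗ₜ fkCoord k (swap l m i) (swap l m j) ∈
      quadraticPerp k (fkRelations k n) := by
  rw [quadraticPerp, Submodule.mem_comap, Submodule.mem_dualAnnihilator]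
  intro r hr
  induction hr using Submodule.span_induction with
  | zero => simp
  | add x y _ _ hx hy => rw [map_add, hx, hy, add_zero]
  | smul c x _ hx => rw [map_smul, hx, smul_zero]
  | mem r hr =>
    cases FKRel.oriented k hr with
    | square a b =>
      simp only [map_add, LinearMap.add_apply, TensorProduct.dualDistrib_apply,
        fkCoord_mul_fkCoord_swap, Equiv.swap_apply_left, Equiv.swap_apply_right]
      rw [fkOriented_swap k a b, map_neg]
      ring
    | triangle a b c hab hbc hca =>
      simp only [map_add, LinearMap.add_apply, TensorProduct.dualDistrib_apply,
        fkCoord_mul_fkCoord_swap, Equiv.swap_apply_right,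
        Equiv.swap_apply_of_ne_of_ne hca hbc.symm, Equiv.swap_apply_of_ne_of_ne hab hca.symm,
        Equiv.swap_apply_of_ne_of_ne hbc hab.symm]
      rw [fkOriented_swap k c a, fkOriented_swap k b c, fkOriented_swap k a b]
      simp only [map_neg]
      ring
    | disjoint a b c d hac had hbc hbd =>
      simp only [map_add, map_sub, LinearMap.add_apply, TensorProduct.dualDistrib_apply,
        fkCoord_mul_fkCoord_swap,
        Equiv.swap_apply_of_ne_of_ne hac had, Equiv.swap_apply_of_ne_of_ne hbc hbd,
        Equiv.swap_apply_of_ne_of_ne hac.symm hbc.symm,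
        Equiv.swap_apply_of_ne_of_ne had.symm hbd.symm]
      ring

end Presentation

/-! ### The universal property of the quadratic dual -/

section Orbit

open Equiv (swap)

variable {n : ℕ}

/-- The permutation `(α, β) ↦ (β, s_β α)` of the pairs of oriented pairs `α = (i, j)`, `β = (l, m)`,
where `s_β` is the transposition of `l` and `m`. Its orbits carry the relations of the quadratic
dual: `Y α * Y β = -(Y β * Y (s_β α))`. -/
def rackPerm (n : ℕ) : Equiv.Perm (Fin n × Fin n × Fin n × Fin n) where
  toFun q := (q.2.2.1, q.2.2.2, swap q.2.2.1 q.2.2.2 q.1, swap q.2.2.1 q.2.2.2 q.2.1)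
  invFun q := (swap q.1 q.2.1 q.2.2.1, swap q.1 q.2.1 q.2.2.2, q.1, q.2.1)
  left_inv q := by simp
  right_inv q := by simp

/-- The values `ρ a b c d` of a bilinear form at `x_{a,b}` and `x_{c,d}`, for a form that vanishes
on the relations of the Fomin-Kirillov algebra. -/
structure VanishesOnFKRel {k : Type*} [Field k] (ρ : Fin n → Fin n → Fin n → Fin n → k) : Prop where
  swap_left (a b c d : Fin n) : ρ b a c d = -ρ a b c d
  swap_right (a b c d : Fin n) : ρ a b d c = -ρ a b c d
  diag_left (a c d : Fin n) : ρ a a c d = 0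
  diag_right (a b c : Fin n) : ρ a b c c = 0
  square (a b : Fin n) : ρ a b a b = 0
  triangle (a b c : Fin n) : a ≠ b → b ≠ c → c ≠ a → ρ a b b c + ρ b c c a + ρ c a a b = 0
  disjoint (a b c d : Fin n) : a ≠ c → a ≠ d → b ≠ c → b ≠ d → ρ a b c d = ρ c d a b

/-- The value of `ρ` at a pair of oriented pairs. -/
def orbitTerm {k : Type*} (ρ : Fin n → Fin n → Fin n → Fin n → k)
    (q : Fin n × Fin n × Fin n × Fin n) : k :=
  ρ q.1 q.2.1 q.2.2.1 q.2.2.2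

/-- Up to orientation, the orbits of `rackPerm` on pairs of distinct pairs have length two or three,
according to whether the two pairs are disjoint or share an index, so that six steps run through
each of them a whole number of times; the alternating sum over one such round is, up to sign, the
value of `ρ` on a relation. -/
theorem VanishesOnFKRel.alternating_sum {k : Type*} [Field k]
    {ρ : Fin n → Fin n → Fin n → Fin n → k}
    (h : VanishesOnFKRel ρ) (q : Fin n × Fin n × Fin n × Fin n) :
    ∑ t ∈ Finset.range 6, (-1) ^ t * orbitTerm ρ ((rackPerm n ^ t) q) = 0 := by
  obtain ⟨a, b, c, d⟩ := q
  simp only [Finset.sum_range_succ, Finset.sum_range_zero, pow_succ, pow_zero, Equiv.Perm.mul_apply,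
    Equiv.Perm.one_apply, zero_add, one_mul, mul_neg, mul_one, neg_neg]
  simp only [rackPerm, Equiv.coe_fn_mk, orbitTerm]
  rcases eq_or_ne a b with rfl | hab
  · simp [h.diag_left, h.diag_right]
  rcases eq_or_ne c d with rfl | hcd
  · simp [h.diag_left, h.diag_right]
  have three (x y z : Fin n) (hxy : x ≠ y) (hyz : y ≠ z) (hzx : z ≠ x) :
      ρ x y y z + ρ y z z x + ρ z x x y = 0 := h.triangle x y z hxy hyz hzx
  rcases eq_or_ne a c with rfl | hac
  · rcases eq_or_ne b d with rfl | hbd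
    · simp [h.swap_left a b, h.swap_right _ _ a b, h.square]
    · simp [hab, hab.symm, hcd, hcd.symm, hbd, hbd.symm, Equiv.swap_apply_of_ne_of_ne]
      have ht := three d b a hbd.symm hab.symm hcd
      simp only [h.swap_left a b, h.swap_left b d, h.swap_left a d,
        h.swap_right _ _ a b, h.swap_right _ _ b d, h.swap_right _ _ a d] at ht ⊢
      linear_combination -2 * ht
  rcases eq_or_ne a d with rfl | had
  · rcases eq_or_ne b c with rfl | hbc
    · simp [h.swap_left a b, h.swap_right _ _ a b, h.square]
    · simp [hab, hab.symm, hcd, hcd.symm, hbc, hbc.symm, Equiv.swap_apply_of_ne_of_ne]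
      have ht := three c b a hbc.symm hab.symm hcd.symm
      simp only [h.swap_left a b, h.swap_left b c, h.swap_left a c,
        h.swap_right _ _ a b, h.swap_right _ _ b c, h.swap_right _ _ a c] at ht ⊢
      linear_combination 2 * ht
  rcases eq_or_ne b c with rfl | hbc
  · simp [hab, hab.symm, hcd, hcd.symm, had, had.symm, Equiv.swap_apply_of_ne_of_ne]
    have ht := three a b d hab hcd had.symm
    simp only [h.swap_left a b, h.swap_left a d,
      h.swap_right _ _ a b, h.swap_right _ _ a d] at ht ⊢
    linear_combination 2 * ht
  rcases eq_or_ne b d with rfl | hbd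
  · simp [hab, hab.symm, hcd, hcd.symm, hac, hac.symm, Equiv.swap_apply_of_ne_of_ne]
    have ht := three a b c hab hbc hac.symm
    simp only [h.swap_left b c, h.swap_left a c,
      h.swap_right _ _ a b, h.swap_right _ _ b c, h.swap_right _ _ a c] at ht ⊢
    linear_combination -2 * ht
  simp [hac, hac.symm, had, had.symm, hbc, hbc.symm, hbd, hbd.symm, Equiv.swap_apply_of_ne_of_ne]
  rw [h.disjoint a b c d hac had hbc hbd]
  ring

/-- Average the sum over six steps of `rackPerm`: the products `Y α * Y β` change sign along an
orbit, so that the coefficients form the alternating sums that vanish. The sum over `i < j`, `l < m`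
is a quarter of the sum over all indices. -/
theorem VanishesOnFKRel.sum_eq_zero {k C : Type*} [Field k] [CharZero k] [Ring C] [Algebra k C]
    {ρ : Fin n → Fin n → Fin n → Fin n → k} (h : VanishesOnFKRel ρ)
    {Y : Fin n → Fin n → C} (hY : IsFKFamily Y) :
    ∑ p : IncPair n, ∑ q : IncPair n,
      ρ p.1.1 p.1.2 q.1.1 q.1.2 • (Y p.1.1 p.1.2 * Y q.1.1 q.1.2) = 0 := by
  let m (q : Fin n × Fin n × Fin n × Fin n) : C := Y q.1 q.2.1 * Y q.2.2.1 q.2.2.2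
  have hm (t : ℕ) (q) : m ((rackPerm n ^ t) q) = (-1 : k) ^ t • m q := by
    induction t with
    | zero => simp
    | succ t ih =>
      have h1 (q) : m (rackPerm n q) = -m q := by
        simp [m, rackPerm, hY.mul_eq q.1 q.2.1 q.2.2.1 q.2.2.2]
      rw [pow_succ', Equiv.Perm.mul_apply, h1, ih, pow_succ', mul_smul, neg_one_smul]
  have hsum : ∑ q, orbitTerm ρ q • m q = 0 := by
    -- each of the six inner sums is a reindexing of the same sum
    have h6 : ∑ t ∈ Finset.range 6, ∑ q, orbitTerm ρ ((rackPerm n ^ t) q) •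
        m ((rackPerm n ^ t) q) = 6 * ∑ q, orbitTerm ρ q • m q := by
      rw [Finset.sum_congr rfl fun t _ =>
        Equiv.sum_comp (rackPerm n ^ t) fun q => orbitTerm ρ q • m q]
      simp
    rw [Finset.sum_comm, Finset.sum_eq_zero] at h6
    · have : (6 : k) • ∑ q, orbitTerm ρ q • m q = 0 := by
        rw [h6, Algebra.smul_def, map_ofNat]
      exact (smul_eq_zero_iff_right (by norm_num)).1 this
    · intro q _
      simp only [hm, smul_smul]
      rw [← Finset.sum_smul, ← zero_smul k (m q), ← h.alternating_sum q]
      simp only [mul_comm]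
  have half (F : Fin n → Fin n → C) (hF : ∀ i j, F j i = F i j) (hd : ∀ i, F i i = 0) :
      ∑ i, ∑ j, F i j = (2 : k) • ∑ p : IncPair n, F p.1.1 p.1.2 := by
    have hsub : ∑ p : IncPair n, F p.1.1 p.1.2 = ∑ i, ∑ j, if i < j then F i j else 0 := by
      rw [← Fintype.sum_prod_type' (f := fun i j => if i < j then F i j else 0),
        ← Finset.sum_filter]
      exact (Finset.sum_subtype _ (fun _ => by simp) fun q : Fin n × Fin n => F q.1 q.2).symm
    rw [hsub, two_smul]
    nth_rewrite 3 [Finset.sum_comm]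
    -- the second copy of the sum has become the sum over `j < i`
    simp only [← Finset.sum_add_distrib]
    refine Finset.sum_congr rfl fun i _ => Finset.sum_congr rfl fun j _ => ?_
    rcases lt_trichotomy i j with hij | rfl | hij
    · simp [hij, hij.le]
    · simp [hd]
    · simp [hij, hij.le, hF]
  have hq : ∑ q, orbitTerm ρ q • m q = ∑ a, ∑ b, ∑ c, ∑ d, ρ a b c d • (Y a b * Y c d) := by
    simp only [Fintype.sum_prod_type, orbitTerm, m]
  rw [hq] at hsum
  rw [half (fun a b => ∑ c, ∑ d, ρ a b c d • (Y a b * Y c d))] at hsum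
  · have hin (p : IncPair n) := half (fun c d => ρ p.1.1 p.1.2 c d • (Y p.1.1 p.1.2 * Y c d))
      (fun c d => by rw [hY.neg_swap c d, h.swap_right]; simp) (fun c => by simp [hY.diag])
    simp only [hin, ← Finset.smul_sum] at hsum
    rw [smul_eq_zero_iff_right two_ne_zero, smul_eq_zero_iff_right two_ne_zero] at hsum
    exact hsum
  · intro a b
    simp only [hY.neg_swap a b, h.swap_left a b]
    simp
  · intro a
    simp [hY.diag]

end Orbit

section Lift

variable (k : Type u) [Field k] {n : ℕ}

theorem dual_eq_sum_fkCoord (f : Module.Dual k (FKSpace k n)) :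
    f = ∑ p : IncPair n, f (fkOriented k p.1.1 p.1.2) • fkCoord k p.1.1 p.1.2 := by
  have hX (p : IncPair n) : fkOriented k p.1.1 p.1.2 = Pi.single p 1 :=
    (fkX_eq_fkOriented k p.1.1 p.1.2 p.2).symm
  refine LinearMap.pi_ext' fun q => LinearMap.ext_ring ?_
  simp [fkCoord, hX, Pi.single_apply, Finset.sum_apply]

/-- The generators of the quadratic dual, for arbitrary `i` and `j` and antisymmetric in them. -/
def fkGen (i j : Fin n) : FKDual k n :=
  QuadraticAlg.gen k (quadraticPerp k (fkRelations k n)) (fkCoord k i j)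

theorem mkAlgHom_tensorToAlgebra {V : Type u} [AddCommGroup V] [Module k V]
    {R : Submodule k (V ⊗[k] V)} {r : V ⊗[k] V} (hr : r ∈ R) :
    RingQuot.mkAlgHom k (quadraticRel k R) (tensorToAlgebra k r) = 0 := by
  have h : quadraticRel k R (tensorToAlgebra k r) 0 := ⟨⟨r, hr, rfl⟩, rfl⟩
  rw [RingQuot.mkAlgHom_rel k h, map_zero]

theorem isFKFamily_fkGen : IsFKFamily (fkGen k (n := n)) where
  diag i := by rw [fkGen, fkCoord_self, map_zero]
  neg_swap i j := by rw [fkGen, fkCoord_swap, map_neg, fkGen]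
  mul_eq i j l m := by
    rw [eq_neg_iff_add_eq_zero]
    have := mkAlgHom_tensorToAlgebra k (fkCoord_rel_mem_perp k i j l m)
    simpa [tensorToAlgebra, fkGen, QuadraticAlg.gen] using this

theorem adjoin_range_fkGen :
    Algebra.adjoin k (Set.range fun p : Fin n × Fin n => fkGen k p.1 p.2) = ⊤ := by
  set S := Algebra.adjoin k (Set.range fun p : Fin n × Fin n => fkGen k p.1 p.2)
  rw [Algebra.eq_top_iff]
  intro x
  obtain ⟨a, rfl⟩ := RingQuot.mkAlgHom_surjective k _ x
  induction a using TensorAlgebra.induction with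
  | algebraMap c => rw [AlgHom.commutes]; exact S.algebraMap_mem c
  | ι f =>
    change QuadraticAlg.gen k (quadraticPerp k (fkRelations k n)) f ∈ S
    rw [dual_eq_sum_fkCoord k f, map_sum]
    refine sum_mem fun p _ => ?_
    rw [map_smul]
    exact S.smul_mem (Algebra.subset_adjoin ⟨p.1, rfl⟩) _
  | mul a b ha hb => rw [map_mul]; exact mul_mem ha hb
  | add a b ha hb => rw [map_add]; exact add_mem ha hb

theorem augmentation_fkGen (i j : Fin n) : FKDual.augmentation k n (fkGen k i j) = 0 := by
  simp [fkGen, FKDual.augmentation, QuadraticAlg.augmentation, QuadraticAlg.gen,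
    TensorAlgebra.algebraMapInv]

theorem vanishesOnFKRel_of_mem_perp
    {r : Module.Dual k (FKSpace k n) ⊗[k] Module.Dual k (FKSpace k n)}
    (hr : r ∈ quadraticPerp k (fkRelations k n)) :
    VanishesOnFKRel fun a b c d : Fin n => TensorProduct.dualDistrib k _ _ r
      (fkOriented k a b ⊗ₜ fkOriented k c d) := by
  have h0 {s} (hs : OrientedRel k s) : TensorProduct.dualDistrib k _ _ r s = 0 :=
    (Submodule.mem_dualAnnihilator _).1 (Submodule.mem_comap.1 hr) s hs.mem
  exact
    { swap_left := fun a b c d => by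
        rw [fkOriented_swap k a b, TensorProduct.neg_tmul, map_neg]
      swap_right := fun a b c d => by
        rw [fkOriented_swap k c d, TensorProduct.tmul_neg, map_neg]
      diag_left := fun a c d => by rw [fkOriented_self, TensorProduct.zero_tmul, map_zero]
      diag_right := fun a b c => by rw [fkOriented_self, TensorProduct.tmul_zero, map_zero]
      square := fun a b => h0 (.square a b)
      triangle := fun a b c hab hbc hca => by
        rw [← map_add, ← map_add, h0 (.triangle a b c hab hbc hca)]
      disjoint := fun a b c d hac had hbc hbd => by
        rw [← sub_eq_zero, ← map_sub, h0 (.disjoint a b c d hac had hbc hbd)] }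

/-- The universal property of the quadratic dual. -/
theorem exists_lift [CharZero k] {C : Type*} [Ring C] [Algebra k C] {Y : Fin n → Fin n → C}
    (hY : IsFKFamily Y) : ∃ φ : FKDual k n →ₐ[k] C, ∀ i j, φ (fkGen k i j) = Y i j := by
  let L : Module.Dual k (FKSpace k n) →ₗ[k] C :=
    ∑ p : IncPair n, (LinearMap.applyₗ (fkOriented k p.1.1 p.1.2)).smulRight (Y p.1.1 p.1.2)
  have hL (f) : L f = ∑ p : IncPair n, f (fkOriented k p.1.1 p.1.2) • Y p.1.1 p.1.2 := by
    simp [L]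
  have hLY (i j : Fin n) : L (fkCoord k i j) = Y i j := by
    have key {i j : Fin n} (h : i < j) : L (fkCoord k i j) = Y i j := by
      rw [hL, Finset.sum_eq_single ⟨(i, j), h⟩]
      · simp [fkCoord_apply, h.ne]
      · rintro ⟨⟨a, b⟩, hab⟩ - hne
        have h1 : ¬ (i = a ∧ j = b) := by
          rintro ⟨rfl, rfl⟩
          exact hne rfl
        have h2 : ¬ (i = b ∧ j = a) := by
          rintro ⟨rfl, rfl⟩
          exact absurd h hab.asymm
        simp [fkCoord_apply, h1, h2]
      · simp
    rcases lt_trichotomy i j with h | rfl | h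
    · exact key h
    · rw [fkCoord_self, map_zero, hY.diag]
    · rw [fkCoord_swap k j i, map_neg, key h, hY.neg_swap j i]
  have hT (r : Module.Dual k (FKSpace k n) ⊗[k] Module.Dual k (FKSpace k n)) :
      TensorAlgebra.lift k L (tensorToAlgebra k r) = ∑ p : IncPair n, ∑ q : IncPair n,
        TensorProduct.dualDistrib k _ _ r
          (fkOriented k p.1.1 p.1.2 ⊗ₜ fkOriented k q.1.1 q.1.2) •
            (Y p.1.1 p.1.2 * Y q.1.1 q.1.2) := by
    induction r using TensorProduct.induction_on with
    | zero => simp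
    | tmul f g =>
      simp [tensorToAlgebra, hL, Finset.sum_mul_sum, smul_smul, mul_comm]
    | add x y hx hy =>
      simp only [map_add, hx, hy, LinearMap.add_apply, add_smul, Finset.sum_add_distrib]
  refine ⟨RingQuot.liftAlgHom k ⟨TensorAlgebra.lift k L, ?_⟩, fun i j => ?_⟩
  · rintro _ _ ⟨⟨r, hr, rfl⟩, rfl⟩
    rw [hT, map_zero]
    exact (vanishesOnFKRel_of_mem_perp k hr).sum_eq_zero hY
  · simp [fkGen, QuadraticAlg.gen, hLY]

end Lift

/-! ### Representations of the quadratic dual -/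

section Representations

open Equiv (swap)

variable (k : Type u) [Field k] {n : ℕ}

theorem fkCoord_mul_fkCoord_flip (i j l m a b : Fin n) :
    fkCoord k l m (fkOriented k a b) * fkCoord k (swap l m i) (swap l m j) (fkOriented k a b) =
      -(fkCoord k l m (fkOriented k a b) * fkCoord k i j (fkOriented k a b)) := by
  rw [fkCoord_mul_fkCoord_swap, Equiv.swap_apply_left, Equiv.swap_apply_right,
    fkOriented_swap k a b, map_neg, mul_neg]

variable {C : Type*} [Ring C] [Algebra k C]

/-- One generator goes to `U`, all others to zero. -/
theorem isFKFamily_smul (U : C) (a b : Fin n) :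
    IsFKFamily fun i j => fkCoord k i j (fkOriented k a b) • U where
  diag i := by simp [fkCoord_self]
  neg_swap i j := by simp [fkCoord_swap k i j]
  mul_eq i j l m := by
    rw [smul_mul_smul_comm, smul_mul_smul_comm, fkCoord_mul_fkCoord_flip, neg_smul, neg_neg,
      mul_comm]

/-- The generators of two disjoint pairs go to anticommuting elements, all others to zero. -/
theorem isFKFamily_smul_add_smul {U W : C} (hUW : U * W = -(W * U)) {a b c d : Fin n}
    (hac : a ≠ c) (had : a ≠ d) (hbc : b ≠ c) (hbd : b ≠ d) :
    IsFKFamily fun i j =>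
      fkCoord k i j (fkOriented k a b) • U + fkCoord k i j (fkOriented k c d) • W where
  diag i := by simp [fkCoord_self]
  neg_swap i j := by
    simp only [fkCoord_swap k i j, LinearMap.neg_apply, neg_smul]
    abel
  mul_eq i j l m := by
    have h1 := fkCoord_mul_fkCoord_swap k i j l m a b c d
    have h2 := fkCoord_mul_fkCoord_swap k i j l m c d a b
    rw [Equiv.swap_apply_of_ne_of_ne hac.symm hbc.symm,
      Equiv.swap_apply_of_ne_of_ne had.symm hbd.symm] at h1
    rw [Equiv.swap_apply_of_ne_of_ne hac had, Equiv.swap_apply_of_ne_of_ne hbc hbd] at h2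
    simp only [mul_add, add_mul, smul_mul_smul_comm, h1, h2, fkCoord_mul_fkCoord_flip, hUW]
    simp only [neg_smul, smul_neg, mul_comm (fkCoord k l m _)]
    abel

theorem IsFKFamily.C_mul_X {R : Type*} [Ring R] {v : Fin n → Fin n → R} (hv : IsFKFamily v) :
    IsFKFamily fun i j => Polynomial.C (v i j) * Polynomial.X where
  diag i := by simp [hv.diag]
  neg_swap i j := by simp [hv.neg_swap i j]
  mul_eq i j l m := by
    have h (r s : R) : (Polynomial.C r * Polynomial.X) * (Polynomial.C s * Polynomial.X) =
        Polynomial.C (r * s) * Polynomial.X ^ 2 := by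
      rw [mul_assoc, ← mul_assoc Polynomial.X, Polynomial.X_mul_C, mul_assoc, ← mul_assoc,
        ← Polynomial.C_mul, sq]
    rw [h, h, hv.mul_eq i j l m, Polynomial.C_neg, neg_mul]

/-- The standard quadratic form on `kⁿ`. -/
def sumSquares (n : ℕ) : QuadraticForm k (Fin n → k) :=
  QuadraticMap.weightedSumSquares k fun _ => (1 : k)

/-- The root `e_i - e_j` as an element of the Clifford algebra. -/
def cliffordRoot (i j : Fin n) : CliffordAlgebra (sumSquares k n) :=
  CliffordAlgebra.ι (sumSquares k n) (Pi.single i 1 - Pi.single j 1)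

theorem sumSquares_root {i j : Fin n} (h : i ≠ j) :
    sumSquares k n (Pi.single i 1 - Pi.single j 1) = 2 := by
  rw [sumSquares, QuadraticMap.weightedSumSquares_apply]
  simp only [one_smul, Pi.sub_apply, sub_mul, Finset.sum_sub_distrib]
  simp [Pi.single_apply, h, h.symm]
  norm_num

theorem polar_sumSquares (v w : Fin n → k) :
    QuadraticMap.polar (sumSquares k n) v w = 2 * ∑ x, v x * w x := by
  simp only [QuadraticMap.polar, sumSquares, QuadraticMap.weightedSumSquares_apply, smul_eq_mul,
    Pi.add_apply, ← Finset.sum_sub_distrib, Finset.mul_sum]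
  exact Finset.sum_congr rfl fun x _ => by ring

theorem cliffordRoot_mul_self {i j : Fin n} (h : i ≠ j) :
    cliffordRoot k i j * cliffordRoot k i j = 2 := by
  rw [cliffordRoot, CliffordAlgebra.ι_sq_scalar, sumSquares_root k h, map_ofNat]

/-- The reflection in the root `e_l - e_m` is the transposition of `l` and `m`, and in a Clifford
algebra a vector passes a root by the negative of that reflection. -/
theorem isFKFamily_cliffordRoot : IsFKFamily (cliffordRoot k (n := n)) where
  diag i := by simp [cliffordRoot]
  neg_swap i j := by rw [cliffordRoot, cliffordRoot, ← map_neg, neg_sub]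
  mul_eq i j l m := by
    rcases eq_or_ne l m with rfl | hlm
    · simp [cliffordRoot]
    set w : Fin n → k := Pi.single l 1 - Pi.single m 1 with hw
    -- the transposition acts on basis vectors as the reflection in `w`
    have hs (x : Fin n) : (Pi.single (swap l m x) 1 : Fin n → k) = Pi.single x 1 - w x • w := by
      rcases eq_or_ne x l with rfl | hxl
      · simp [hw, hlm]
      rcases eq_or_ne x m with rfl | hxm
      · simp [hw, hlm.symm]
      · simp [hw, hxl, hxm, Equiv.swap_apply_of_ne_of_ne]
    have hroot : (Pi.single (swap l m i) 1 - Pi.single (swap l m j) 1 : Fin n → k) =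
        (Pi.single i 1 - Pi.single j 1) - (w i - w j) • w := by
      rw [hs, hs, sub_smul]
      abel
    have hp : QuadraticMap.polar (sumSquares k n) (Pi.single i 1 - Pi.single j 1) w =
        (w i - w j) * 2 := by
      rw [polar_sumSquares, mul_comm]
      simp [sub_mul, Pi.single_apply]
    have hadd := CliffordAlgebra.ι_mul_ι_add_swap (Q := sumSquares k n)
      (Pi.single i 1 - Pi.single j 1) w
    rw [hp, map_mul, map_ofNat, ← cliffordRoot_mul_self k hlm] at hadd
    rw [eq_neg_iff_add_eq_zero, cliffordRoot, cliffordRoot, cliffordRoot, hroot, ← hw,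
      LinearMap.map_sub _ _ ((w i - w j) • w), map_smul, mul_sub, add_sub, hadd, mul_smul_comm,
      ← Algebra.smul_def, cliffordRoot, ← hw, sub_self]

end Representations

/-! ### The depth -/

section Depth

open CategoryTheory Polynomial

variable {k B : Type u} [Field k] [Ring B] [Algebra k B]

theorem moduleDepth_le_one (ε : B →ₐ[k] k) (M : ModuleCat.{u} B) (φ : B ≃ₗ[B] M)
    (h : (∀ x : B, (∀ b ∈ RingHom.ker ε, b * x = 0) → x = 0) →
      ¬ ExtendsByMul (RingHom.ker ε)) : moduleDepth ε.toRingHom M ≤ 1 := by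
  by_contra! hd
  have h0 : Subsingleton (Abelian.Ext.{u} (trivialModule ε.toRingHom) M 0) :=
    subsingleton_ext_of_lt_moduleDepth (by exact_mod_cast zero_lt_one.trans hd)
  have h1 : Subsingleton (Abelian.Ext.{u} (trivialModule ε.toRingHom) M 1) :=
    subsingleton_ext_of_lt_moduleDepth (by exact_mod_cast hd)
  refine h (fun x hx => ?_) fun f => ?_
  · refine φ.map_eq_zero_iff.1 (eq_zero_of_ext_zero ε M _ fun b hb => ?_)
    rw [← map_smul, smul_eq_mul, hx b hb, map_zero]
  · obtain ⟨m, hm⟩ := exists_eq_smul_of_subsingleton_ext_one ε M (φ.toLinearMap ∘ₗ f)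
    refine ⟨φ.symm m, fun x => φ.injective ?_⟩
    rw [← smul_eq_mul, map_smul, φ.apply_symm_apply]
    exact hm x

variable {n : ℕ} {Y : Fin n → Fin n → B}

/-- For `n = 2` the algebra is `k[X]` and the augmentation ideal is free on `Y 0 1`; the map `b * Y
0 1 ↦ b` is not a multiplication. -/
theorem not_extendsByMul_of_two {Y : Fin 2 → Fin 2 → B} (hY : IsFKFamily Y)
    (hgen : Algebra.adjoin k (Set.range fun p : Fin 2 × Fin 2 => Y p.1 p.2) = ⊤)
    (ε : B →ₐ[k] k) (hε : ∀ i j, ε (Y i j) = 0) (ψ : B →ₐ[k] k[X])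
    (hψ : ∀ i j, ψ (Y i j) = C (fkCoord k i j (fkOriented k 0 1)) * X) :
    ¬ ExtendsByMul (RingHom.ker ε) := by
  intro h1
  have hψ01 : ψ (Y 0 1) = X := by simp [hψ, fkCoord_apply]
  have hcomp : (aeval (Y 0 1)).comp ψ = AlgHom.id k B := by
    refine AlgHom.ext_of_adjoin_eq_top hgen ?_
    rintro _ ⟨⟨i, j⟩, rfl⟩
    fin_cases i <;> fin_cases j <;> simp [hψ, fkCoord_apply, hY.diag, hY.neg_swap 0 1]
  have hinj (b : B) (hb : b * Y 0 1 = 0) : b = 0 := by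
    have h := congrArg ψ hb
    rw [map_mul, hψ01, map_zero] at h
    have h' := (mul_eq_zero.1 h).resolve_right X_ne_zero
    rw [← AlgHom.id_apply (R := k) b, ← hcomp, AlgHom.comp_apply, h', map_zero]
  have hmem : Y 0 1 ∈ RingHom.ker ε := hε 0 1
  let g : B →ₗ[B] RingHom.ker ε := LinearMap.toSpanSingleton B _ ⟨Y 0 1, hmem⟩
  have hg (b : B) : (g b : B) = b * Y 0 1 := rfl
  have hbij : Function.Bijective g := by
    constructor
    · rw [injective_iff_map_eq_zero]
      intro b hb
      exact hinj b (by rw [← hg, hb]; rfl)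
    · rintro ⟨x, hx⟩
      have hx' := hx
      rw [ker_eq_span_range hgen ε fun p => hε p.1 p.2] at hx'
      have hle : Ideal.span (Set.range fun p : Fin 2 × Fin 2 => Y p.1 p.2) ≤
          Ideal.span {Y 0 1} := by
        rw [Ideal.span_le]
        have h01 : Y 0 1 ∈ Ideal.span {Y 0 1} := Ideal.subset_span rfl
        rintro _ ⟨⟨i, j⟩, rfl⟩
        fin_cases i <;> fin_cases j <;> simp [hY.diag, hY.neg_swap 0 1, h01]
      obtain ⟨b, hb⟩ := Ideal.mem_span_singleton'.1 (hle hx')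
      exact ⟨b, Subtype.ext hb⟩
  let e := LinearEquiv.ofBijective g hbij
  obtain ⟨m, hm⟩ := h1 e.symm.toLinearMap
  have h2 := hm ⟨Y 0 1, hmem⟩
  have h3 : e.symm ⟨Y 0 1, hmem⟩ = 1 := by
    rw [LinearEquiv.symm_apply_eq]
    exact Subtype.ext (by rw [LinearEquiv.ofBijective_apply, hg, one_mul])
  have h4 := congrArg ε (h3.symm.trans h2)
  rw [map_mul, hε, zero_mul, map_one] at h4
  exact one_ne_zero h4

theorem not_extendsByMul [CharZero k] (hn : 2 ≤ n) (hY : IsFKFamily Y)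
    (hgen : Algebra.adjoin k (Set.range fun p : Fin n × Fin n => Y p.1 p.2) = ⊤)
    (ε : B →ₐ[k] k) (hε : ∀ i j, ε (Y i j) = 0)
    (hlift : ∀ {R : Type u} [Ring R] [Algebra k R] {Z : Fin n → Fin n → R}, IsFKFamily Z →
      ∃ φ : B →ₐ[k] R, ∀ i j, φ (Y i j) = Z i j)
    (h0 : ∀ x : B, (∀ b ∈ RingHom.ker ε, b * x = 0) → x = 0) :
    ¬ ExtendsByMul (RingHom.ker ε) := by
  have hedge (a b : Fin n) : ∃ ψ : B →ₐ[k] k[X],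
      ∀ i j, ψ (Y i j) = C (fkCoord k i j (fkOriented k a b)) * X := by
    obtain ⟨ψ, hψ⟩ := hlift (isFKFamily_smul k (X : k[X]) a b)
    exact ⟨ψ, fun i j => by rw [hψ, smul_eq_C_mul]⟩
  rcases hn.eq_or_lt with rfl | hn3
  · obtain ⟨ψ, hψ⟩ := hedge 0 1
    exact not_extendsByMul_of_two hY hgen ε hε ψ hψ
  · intro h1
    let a : Fin n := ⟨0, by omega⟩
    let b : Fin n := ⟨1, by omega⟩
    let c : Fin n := ⟨2, by omega⟩
    have hab : a ≠ b := by simp [a, b]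
    have hac : a ≠ c := by simp [a, c]
    have hbc : b ≠ c := by simp [b, c]
    obtain ⟨e, he, he'⟩ := IsFKFamily.exists_idempotent hn hY hgen ε hε h0 h1
    obtain ⟨φ, hφ⟩ := hlift (isFKFamily_cliffordRoot k (n := n)).C_mul_X
    obtain ⟨ψ, hψ⟩ := hedge a b
    have : Invertible (2 : k) := invertibleOfNonzero two_ne_zero
    exact IsFKFamily.not_exists_idempotent hgen ε hε φ hφ
      (fun i j h => cliffordRoot_mul_self k h) ψ hψ hab hac
      (by simp [fkCoord_apply, hab]) (by simp [fkCoord_apply, hab, hbc.symm]) he he'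

theorem leftDepth_le_one (k : Type u) [Field k] [CharZero k] {n : ℕ} (hn : 2 ≤ n) :
    FKDual.leftDepth k n ≤ 1 :=
  moduleDepth_le_one _ _ (LinearEquiv.refl _ _) fun h0 =>
    not_extendsByMul hn (isFKFamily_fkGen k) (adjoin_range_fkGen k) _ (augmentation_fkGen k)
      (exists_lift k) h0

theorem rightDepth_le_one (k : Type u) [Field k] [CharZero k] {n : ℕ} (hn : 2 ≤ n) :
    FKDual.rightDepth k n ≤ 1 := by
  let e : (FKDual k n)ᵐᵒᵖ ≃ₗ[(FKDual k n)ᵐᵒᵖ] FKDual k n :=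
    { MulOpposite.opAddEquiv.symm with
      map_smul' := fun _ _ => rfl }
  refine moduleDepth_le_one _ _ e fun h0 =>
    not_extendsByMul hn (isFKFamily_fkGen k).op ?_ _ (augmentation_fkGen k) ?_ h0
  · rw [← Subalgebra.op_top, ← adjoin_range_fkGen k, Subalgebra.op_adjoin]
    congr 1
    ext x
    constructor
    · rintro ⟨p, rfl⟩
      exact ⟨p, rfl⟩
    · rintro ⟨p, hp⟩
      exact ⟨p, MulOpposite.unop_injective hp⟩
  · intro R _ _ Z hZ
    obtain ⟨φ, hφ⟩ := exists_lift k hZ.op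
    exact ⟨AlgHom.opComm φ, fun i j => by simp [hφ]⟩

end Depth

/-! ### Growth of the quadratic dual -/

section Growth

variable (k : Type u) [Field k] {n : ℕ}

/-- The operator `e_{i,j} ↦ e_{i+1,j}` on the vector space with basis `ℕ × ℕ`. -/
def shiftFst : Module.End k (ℕ × ℕ →₀ k) :=
  Finsupp.linearCombination k fun p => Finsupp.single (p.1 + 1, p.2) 1

/-- The operator `e_{i,j} ↦ (-1)^i e_{i,j+1}`; the sign makes it anticommute with `shiftFst`. -/
def signedShiftSnd : Module.End k (ℕ × ℕ →₀ k) :=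
  Finsupp.linearCombination k fun p => (-1) ^ p.1 • Finsupp.single (p.1, p.2 + 1) 1

theorem shiftFst_mul_signedShiftSnd :
    shiftFst k * signedShiftSnd k = -(signedShiftSnd k * shiftFst k) := by
  ext p : 2
  ext : 1
  simp [shiftFst, signedShiftSnd, pow_succ]

theorem shift_pow_apply (i j : ℕ) : (shiftFst k ^ i * signedShiftSnd k ^ j)
    (Finsupp.single (0, 0) 1) = Finsupp.single (i, j) 1 := by
  have hj : (signedShiftSnd k ^ j) (Finsupp.single (0, 0) 1) = Finsupp.single (0, j) 1 := by
    induction j with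
    | zero => simp
    | succ j ih => rw [pow_succ', Module.End.mul_apply, ih]; simp [signedShiftSnd]
  rw [Module.End.mul_apply, hj]
  induction i with
  | zero => simp
  | succ i ih => rw [pow_succ', Module.End.mul_apply, ih]; simp [shiftFst]

/-- The products of `i` copies of one generator and `d - i` copies of a generator with disjoint
indices are linearly independent. -/
theorem succ_le_finrank_piece [CharZero k] (hn : 4 ≤ n) (d : ℕ) :
    d + 1 ≤ Module.finrank k
      (QuadraticAlg.piece k (quadraticPerp k (fkRelations k n)) d) := by
  set P := QuadraticAlg.piece k (quadraticPerp k (fkRelations k n))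
  let a : Fin n := ⟨0, by omega⟩
  let b : Fin n := ⟨1, by omega⟩
  let c : Fin n := ⟨2, by omega⟩
  let e : Fin n := ⟨3, by omega⟩
  obtain ⟨θ, hθ⟩ := exists_lift k (isFKFamily_smul_add_smul k
    (C := Module.End k (ℕ × ℕ →₀ k)) (shiftFst_mul_signedShiftSnd k)
    (a := a) (b := b) (c := c) (d := e)
    (by simp [a, c]) (by simp [a, e]) (by simp [b, c]) (by simp [b, e]))
  have hab : θ (fkGen k a b) = shiftFst k := by
    rw [hθ]; simp [fkCoord_apply, a, b, c, e]
  have hce : θ (fkGen k c e) = signedShiftSnd k := by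
    rw [hθ]; simp [fkCoord_apply, a, b, c, e]
  have hmem (i : Fin (d + 1)) :
      fkGen k a b ^ (i : ℕ) * fkGen k c e ^ (d - i : ℕ) ∈ P d := by
    have hg (i j : Fin n) (m : ℕ) : fkGen k i j ^ m ∈ P m :=
      Submodule.pow_mem_pow _ (LinearMap.mem_range_self _ (fkCoord k i j)) m
    have := Submodule.mul_mem_mul (hg a b i) (hg c e (d - i))
    simp only [P, QuadraticAlg.piece] at this ⊢
    rwa [← pow_add, Nat.add_sub_cancel' (Nat.lt_succ_iff.1 i.2)] at this
  have hfin : Module.Finite k (P d) := by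
    refine Module.Finite.iff_fg.2 (Submodule.FG.pow ?_ d)
    rw [LinearMap.range_eq_map]
    exact Submodule.FG.map _ Module.Finite.fg_top
  let ev : P d →ₗ[k] (ℕ × ℕ →₀ k) :=
    LinearMap.applyₗ (Finsupp.single (0, 0) 1) ∘ₗ θ.toLinearMap ∘ₗ (P d).subtype
  have hli : LinearIndependent k fun i : Fin (d + 1) => (⟨_, hmem i⟩ : P d) := by
    refine LinearIndependent.of_comp ev ?_
    have : (ev ∘ fun i : Fin (d + 1) => (⟨_, hmem i⟩ : P d)) =
        (fun p => Finsupp.single p 1) ∘ fun i : Fin (d + 1) => ((i : ℕ), (d - i : ℕ)) := by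
      funext i
      change θ (fkGen k a b ^ (i : ℕ) * fkGen k c e ^ (d - i : ℕ)) _ = _
      rw [map_mul, map_pow, map_pow, hab, hce, shift_pow_apply]
      rfl
    rw [this]
    refine (Finsupp.linearIndependent_single_one k (ℕ × ℕ)).comp _ fun i j hij => ?_
    exact Fin.ext (Prod.ext_iff.1 hij).1
  simpa using hli.fintype_card_le_finrank

/-- The sum of the dimensions up to degree `N` is at least `N ^ 2 / 2`, hence at least `N ^ (3 / 2)`
for `N ≥ 4`, so that the upper limit is at least `3 / 2`. -/
theorem one_lt_GKdim {A : Type u} [Ring A] [Algebra k A] {P : ℕ → Submodule k A}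
    (hP : ∀ d, d + 1 ≤ Module.finrank k (P d)) : 1 < GKdim k P := by
  refine lt_of_lt_of_le (b := ((3 / 2 : ℝ) : EReal)) (by norm_cast; norm_num) ?_
  refine Filter.le_limsup_of_frequently_le' (Filter.Eventually.frequently ?_)
  filter_upwards [Filter.eventually_ge_atTop 4] with N hN
  rw [EReal.coe_le_coe_iff]
  have hN' : (4 : ℝ) ≤ N := by exact_mod_cast hN
  have hlog : 0 < Real.log N := Real.log_pos (by linarith)
  rw [le_div_iff₀ hlog]
  set S : ℝ := ∑ i ∈ Finset.range (N + 1), (Module.finrank k (P i) : ℝ)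
  have hS : (N : ℝ) ^ 2 / 2 ≤ S := by
    have h1 : ∑ i ∈ Finset.range (N + 1), ((i : ℝ) + 1) ≤ S :=
      Finset.sum_le_sum fun i _ => by exact_mod_cast hP i
    have h2 (M : ℕ) : (M : ℝ) ^ 2 / 2 ≤ ∑ i ∈ Finset.range M, ((i : ℝ) + 1) := by
      induction M with
      | zero => simp
      | succ M ih => rw [Finset.sum_range_succ]; push_cast; linarith
    have h3 := h2 (N + 1)
    push_cast at h3
    nlinarith
  have hS2 : (N : ℝ) ^ 3 ≤ S ^ 2 := by
    have : ((N : ℝ) ^ 2 / 2) ^ 2 ≤ S ^ 2 := by gcongr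
    nlinarith [pow_nonneg (show (0 : ℝ) ≤ N by linarith) 3]
  have := Real.log_le_log (by positivity) hS2
  rw [Real.log_pow, Real.log_pow] at this
  push_cast at this
  linarith

end Growth

end

theorem theorem3p12 (k : Type u) [Field k] [IsAlgClosed k] [CharZero k] (n : ℕ) (hn : 2 ≤ n) :
    FKDual.leftDepth k n ≤ 1 ∧ FKDual.rightDepth k n ≤ 1 ∧
      (4 ≤ n →
        ((FKDual.leftDepth k n : ℝ≥0∞) : EReal) < FKDual.gkdim k n ∧
        ((FKDual.rightDepth k n : ℝ≥0∞) : EReal) < FKDual.gkdim k n) := by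
  refine ⟨leftDepth_le_one k hn, rightDepth_le_one k hn, fun h4 => ?_⟩
  have hgk : 1 < FKDual.gkdim k n := one_lt_GKdim k (succ_le_finrank_piece k h4)
  have hcast {d : ℕ∞} (hd : d ≤ 1) : ((d : ℝ≥0∞) : EReal) < FKDual.gkdim k n := by
    refine lt_of_le_of_lt ?_ hgk
    exact_mod_cast hd
  exact ⟨hcast (leftDepth_le_one k hn), hcast (rightDepth_le_one k hn)⟩
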